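/- Let a signature be a finite set of predicate symbols with arities, containing a special predicate $\bot$ of arity $0$; a fact is a ground atom over the signature, and a database is a finite set of facts not containing $\bot$. A conjunctive query with inequalities (CQ) is a formula $\exists \vec y\,\gamma$, where $\gamma$ is a nonempty conjunction of predicate atoms and of inequalities $t\neq t'$ between terms (variables or constants; distinct constants denote distinct objects), and each variable in $\vec y$ occurs in $\gamma$; it is safe if each of its variables occurs in a predicate atom. A BUCQ is a nonempty finite disjunction of CQs without free variables; it is safe if all its CQs are. A dependency is a sentence $\forall \vec x\,(\gamma\rightarrow q_1\vee\dots\vee q_m)$, $m\ge 1$, where $\gamma$ is such a conjunction with variables $\vec x$, each of which occurs in a predicate atom of $\gamma$, and where the $q_i$ are CQs with free variables among $\vec x$, each of whose quantified variables occurs in a predicate atom of that $q_i$. It is linear if exactly one predicate atom occurs in $\gamma$. For a set $\Sigma$ of dependencies and a database $\mathcal D$, a repair of $\langle\Sigma,\mathcal D\rangle$ is an inclusion-maximal subset of $\mathcal D$ that satisfies all dependencies of $\Sigma$; $\langle\Sigma,\mathcal D\rangle$ AR-entails $Q$ if $Q$ is true in every repair, and IAR-entails $Q$ if $Q$ is true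 in the intersection of all repairs. Theorem. For every finite set $\Sigma$ of linear dependencies and every safe BUCQ $Q$ (both fixed), the problem of deciding, given a database $\mathcal D$, whether $\langle\Sigma,\mathcal D\rangle$ IAR-entails $Q$ is in PTIME, i.e. it is solvable by a deterministic Turing machine in time polynomial in the size of $\mathcal D$. The same holds for AR-entailment, and, for every database $\mathcal D$, $\langle\Sigma,\mathcal D\rangle$ AR-entails $Q$ if and only if it IAR-entails $Q$. -/

import Mathlib

/-- A predicate signature: predicate symbols with arities, among them the special predicate `⊥`
of arity `0`. -/
structure Signature where
  Pred : Type
  arity : Pred → ℕ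
  bot : Pred
  arity_bot : arity bot = 0

/-- Constant symbols are finite bit strings (distinct strings are distinct constants). -/
abbrev Const : Type := List Bool

/-- Variable symbols. -/
abbrev Var : Type := ℕ

/-- A term is a variable or a constant. -/
inductive Term where
  | var (x : Var)
  | const (c : Const)

/-- The value of a term under an assignment of constants to the variables. -/
def Term.val (ν : Var → Const) : Term → Const
  | .var x => ν x
  | .const c => c

/-- A predicate atom `p(t₁, …, tₙ)`, where `n` is the arity of `p`. -/
structure Atom (S : Signature) where
  pred : S.Pred
  args : Fin (S.arity pred) → Term

/-- A fact, i.e. a ground predicate atom. -/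
structure DBFact (S : Signature) where
  pred : S.Pred
  args : Fin (S.arity pred) → Const

/-- The fact obtained from an atom by an assignment of constants to the variables. -/
def Atom.ground {S : Signature} (ν : Var → Const) (α : Atom S) : DBFact S where
  pred := α.pred
  args := fun i => (α.args i).val ν

/-- The variables occurring in a predicate atom. -/
def Atom.vars {S : Signature} (α : Atom S) : Set Var :=
  {x | ∃ i, α.args i = Term.var x}

/-- A nonempty conjunction of predicate atoms and inequality atoms; the pair `(t, t')` in `ineqs`
is the inequality `t ≠ t'`. -/
structure Conjunction (S : Signature) where
  atoms : List (Atom S)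
  ineqs : List (Term × Term)
  nonempty : 1 ≤ atoms.length + ineqs.length

namespace Conjunction

variable {S : Signature}

/-- The set of predicate atoms occurring in the conjunction. -/
def PA (γ : Conjunction S) : Set (Atom S) := {α | α ∈ γ.atoms}

/-- The variables occurring in the predicate atoms of the conjunction. -/
def atomVars (γ : Conjunction S) : Set Var := {x | ∃ α ∈ γ.PA, x ∈ α.vars}

/-- All the variables occurring in the conjunction. -/
def vars (γ : Conjunction S) : Set Var :=
  γ.atomVars ∪ {x | ∃ e ∈ γ.ineqs, e.1 = Term.var x ∨ e.2 = Term.var x}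

/-- Truth of the conjunction in a set of facts, under an assignment. -/
def Holds (D : Set (DBFact S)) (ν : Var → Const) (γ : Conjunction S) : Prop :=
  (∀ α ∈ γ.atoms, α.ground ν ∈ D) ∧ ∀ e ∈ γ.ineqs, e.1.val ν ≠ e.2.val ν

end Conjunction

/-- A conjunctive query with inequalities `∃ y (γ)`; each variable in `y` occurs in some atom
of `γ`. -/
structure CQ (S : Signature) where
  exVars : Finset Var
  conj : Conjunction S
  exVars_occur : ∀ y ∈ exVars, y ∈ conj.vars

namespace CQ

variable {S : Signature}

/-- The free variables of a CQ. -/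
def freeVars (q : CQ S) : Set Var := {x | x ∈ q.conj.vars ∧ x ∉ q.exVars}

/-- A CQ is safe if every variable of it occurs in at least one predicate atom. -/
def IsSafe (q : CQ S) : Prop := ∀ x ∈ q.conj.vars, x ∈ q.conj.atomVars

/-- A CQ is Boolean if it has no free variable. -/
def IsBoolean (q : CQ S) : Prop := q.freeVars = ∅

/-- Truth of a CQ in a set of facts, under an assignment of its free variables. -/
def Holds (D : Set (DBFact S)) (ν : Var → Const) (q : CQ S) : Prop :=
  ∃ ν' : Var → Const, (∀ x, x ∉ q.exVars → ν' x = ν x) ∧ q.conj.Holds D ν'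

end CQ

/-- A union of conjunctive queries `q₁ ∨ … ∨ qₘ`, with `m ≥ 1`. -/
structure UCQ (S : Signature) where
  cqs : List (CQ S)
  nonempty : 1 ≤ cqs.length

namespace UCQ

variable {S : Signature}

/-- A UCQ is safe if all its CQs are. -/
def IsSafe (Q : UCQ S) : Prop := ∀ q ∈ Q.cqs, q.IsSafe

/-- A UCQ is Boolean (a BUCQ) if all its CQs are. -/
def IsBoolean (Q : UCQ S) : Prop := ∀ q ∈ Q.cqs, q.IsBoolean

/-- Truth of a UCQ in a set of facts, under an assignment of its free variables. -/
def Holds (D : Set (DBFact S)) (ν : Var → Const) (Q : UCQ S) : Prop :=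
  ∃ q ∈ Q.cqs, q.Holds D ν

/-- `D ⊨ Q`: truth of a UCQ in a set of facts (used for Boolean `Q`, whose truth does not depend
on the assignment). -/
def Models (D : Set (DBFact S)) (Q : UCQ S) : Prop :=
  ∀ ν : Var → Const, Q.Holds D ν

end UCQ

/-- A (disjunctive embedded) dependency with inequalities `∀ x (γ → Q)`. Since `∃ x (γ)` is a
Boolean CQ, `x` consists of exactly the variables of `γ`, so it is not recorded. -/
structure Dependency (S : Signature) where
  body : Conjunction S
  head : UCQ S
  /-- `∃ x (γ)` is safe. -/
  body_safe : ∀ x ∈ body.vars, x ∈ body.atomVars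
  /-- The free variables of `Q` are among `x`. -/
  head_free : ∀ q ∈ head.cqs, ∀ x ∈ q.freeVars, x ∈ body.vars
  /-- The BUCQ `Q(t)`, with constants `t` for the free variables, is safe: the variables that
  remain in it are the quantified ones. -/
  head_safe : ∀ q ∈ head.cqs, ∀ y ∈ q.exVars, y ∈ q.conj.atomVars

namespace Dependency

variable {S : Signature}

/-- The dependency is satisfied in the set of facts `D`. -/
def Satisfied (D : Set (DBFact S)) (τ : Dependency S) : Prop :=
  ∀ ν : Var → Const, τ.body.Holds D ν → τ.head.Holds D ν

/-- A dependency is linear if exactly one predicate atom occurs in its body. -/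
def IsLinear (τ : Dependency S) : Prop := τ.body.PA.ncard = 1

end Dependency

section Repairs

variable {S : Signature}

/-- `D` is consistent with the set of dependencies `T`. -/
def Consistent (T : Set (Dependency S)) (D : Set (DBFact S)) : Prop :=
  ∀ τ ∈ T, τ.Satisfied D

/-- `R` is a repair of `⟨T, D⟩`: a subset of `D` consistent with `T` and maximal (with respect to
inclusion) with this property. -/
def IsRepair (T : Set (Dependency S)) (D R : Set (DBFact S)) : Prop :=
  Maximal (fun R' => R' ⊆ D ∧ Consistent T R') R

/-- The intersection of all the repairs. -/
def intRep (T : Set (Dependency S)) (D : Set (DBFact S)) : Set (DBFact S) :=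
  {f | ∀ R, IsRepair T D R → f ∈ R}

/-- `⟨T, D⟩` AR-entails `Q`. -/
def AREntails (T : Set (Dependency S)) (D : Set (DBFact S)) (Q : UCQ S) : Prop :=
  ∀ R, IsRepair T D R → Q.Models R

/-- `⟨T, D⟩` IAR-entails `Q`. -/
def IAREntails (T : Set (Dependency S)) (D : Set (DBFact S)) (Q : UCQ S) : Prop :=
  Q.Models (intRep T D)

end Repairs

/-- A (finite) database, presented as the list of its facts, in any order and possibly with
repetitions. No database contains the fact `⊥`. -/
structure Database (S : Signature) where
  list : List (DBFact S)
  bot_notMem : ∀ f ∈ list, f.pred ≠ S.bot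

/-- The set of facts of a database. -/
def Database.facts {S : Signature} (D : Database S) : Set (DBFact S) := {f | f ∈ D.list}

/-- The letters used to write down databases: one for each predicate symbol, the two bits, and an
end marker for constants. -/
inductive Letter (S : Signature) where
  | pred (p : S.Pred)
  | bit (b : Bool)
  | sep

/-- The fact `p(c₁, …, cₙ)` is written as the letter `p` followed by the bit strings
`c₁, …, cₙ`, each followed by the end marker. -/
def DBFact.encode {S : Signature} (f : DBFact S) : List (Letter S) :=
  Letter.pred f.pred ::
    (List.ofFn f.args).flatMap (fun c => c.map Letter.bit ++ [Letter.sep])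

/-- A database is written as the concatenation of its facts. -/
def Database.encode {S : Signature} (D : Database S) : List (Letter S) :=
  D.list.flatMap DBFact.encode

/-- The decision problem `P`, whose instances are written as strings by `enc`, is in PTIME:
a deterministic multi-stack Turing machine decides it in a number of steps that is bounded by
a polynomial in the length of the string. -/
def InPTIME {α Γ : Type} (enc : α → List Γ) (P : α → Prop) : Prop :=
  ∃ f : α → Bool, (∀ a, f a = true ↔ P a) ∧
    Nonempty (Turing.TM2ComputableInPolyTime enc Computability.encodeBool f)

/-! A match of a linear body uses a single fact, so a set of facts satisfies a linear dependency
exactly when each of its facts does so individually (`Dependency.IsLinear.satisfied_iff`). The rest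
of the set matters only for the head, whose truth is preserved when facts are added
(`Dependency.SatisfiedAt.mono`). Hence a fact that violates a dependency in some set lies in no
consistent subset of it, and discarding violating facts until none is left yields the greatest
consistent subset. This is the only repair (`isRepair_iff`), so AR- and IAR-entailment both mean
truth in it.

There are at most as many effective rounds as facts. Since the dependencies and the query are fixed,
the number of variables is a constant; safety confines all relevant values to the constants of the
current facts, so each test is a bounded number of nested loops (`TreePolyTime.evalRepair`).

To obtain a genuine Turing machine, structured programs are compiled to stack machines with exact
control of time (`Prog.Exec.within`). Data are binary trees, kept in preorder on one stack. The
functions computable in polynomial time on trees are closed under composition, pairing, case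
distinction and iteration along a list with polynomially bounded intermediate results
(`TreePolyTime.foldl`); everything else is built from these. `TreePolyTime.inPTIME` adds the reading
of the input and the output of the answer. -/

open Turing Function

/-! ### Structured programs and their compilation to stack machines -/

/-- Structured programs over a family of stacks `Γ`, with a register of type `σ`. -/
inductive Prog {K : Type} (Γ : K → Type) (σ : Type) where
  | push (k : K) (f : σ → Γ k)
  | pop (k : K) (f : σ → Option (Γ k) → σ)
  | load (f : σ → σ)
  | seq (p q : Prog Γ σ)
  | ite (b : σ → Bool) (p q : Prog Γ σ)
  | loop (b : σ → Bool) (p : Prog Γ σ)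

namespace Prog

variable {K : Type} {Γ : K → Type} {σ : Type}

/-- The labels of the machine code of a program. -/
def Lab : Prog Γ σ → Type
  | push _ _ => Unit
  | pop _ _ => Unit
  | load _ => Unit
  | seq p q => p.Lab ⊕ q.Lab
  | ite _ p q => Option (p.Lab ⊕ q.Lab)
  | loop _ p => Option p.Lab

/-- The label at which the execution of a program starts. -/
def entry : (p : Prog Γ σ) → p.Lab
  | push _ _ => ()
  | pop _ _ => ()
  | load _ => ()
  | seq p _ => Sum.inl p.entry
  | ite _ _ _ => none
  | loop _ _ => none

theorem finite_lab : ∀ p : Prog Γ σ, Finite p.Lab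
  | push _ _ => inferInstanceAs (Finite Unit)
  | pop _ _ => inferInstanceAs (Finite Unit)
  | load _ => inferInstanceAs (Finite Unit)
  | seq p q => by
      have := p.finite_lab
      have := q.finite_lab
      exact inferInstanceAs (Finite (p.Lab ⊕ q.Lab))
  | ite _ p q => by
      have := p.finite_lab
      have := q.finite_lab
      exact inferInstanceAs (Finite (Option (p.Lab ⊕ q.Lab)))
  | loop _ p => by
      have := p.finite_lab
      exact inferInstanceAs (Finite (Option p.Lab))

/-- The machine code of a program whose labels are embedded in `Λ` by `i`, and which jumps to `e`
when it is finished. -/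
def code {Λ : Type} : (p : Prog Γ σ) → (p.Lab → Λ) → Λ → p.Lab → TM2.Stmt Γ Λ σ
  | push k f, _, e, _ => .push k f (.goto fun _ => e)
  | pop k f, _, e, _ => .pop k f (.goto fun _ => e)
  | load f, _, e, _ => .load f (.goto fun _ => e)
  | seq p q, i, _, Sum.inl l => p.code (fun x => i (Sum.inl x)) (i (Sum.inr q.entry)) l
  | seq _ q, i, e, Sum.inr l => q.code (fun x => i (Sum.inr x)) e l
  | ite b p q, i, _, none =>
      .branch b (.goto fun _ => i (some (Sum.inl p.entry)))
        (.goto fun _ => i (some (Sum.inr q.entry)))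
  | ite _ p _, i, e, some (Sum.inl l) => p.code (fun x => i (some (Sum.inl x))) e l
  | ite _ _ q, i, e, some (Sum.inr l) => q.code (fun x => i (some (Sum.inr x))) e l
  | loop b p, i, e, none =>
      .branch b (.goto fun _ => i (some p.entry)) (.goto fun _ => e)
  | loop _ p, i, _, some l => p.code (fun x => i (some x)) (i none) l

variable [DecidableEq K]

/-- `Exec p v s n v' s'`: from register `v` and stacks `s`, the program `p` terminates within `n`
steps with register `v'` and stacks `s'`. -/
inductive Exec : Prog Γ σ → σ → (∀ k, List (Γ k)) → ℕ → σ → (∀ k, List (Γ k)) → Prop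
  | push {k f v s} : Exec (push k f) v s 1 v (update s k (f v :: s k))
  | pop {k f v s} : Exec (pop k f) v s 1 (f v (s k).head?) (update s k (s k).tail)
  | load {f v s} : Exec (load f) v s 1 (f v) s
  | seq {p q v s n v' s' m v'' s''} (h : Exec p v s n v' s') (h' : Exec q v' s' m v'' s'') :
      Exec (seq p q) v s (n + m) v'' s''
  | ite_true {b p q v s n v' s'} (hb : b v = true) (h : Exec p v s n v' s') :
      Exec (ite b p q) v s (n + 1) v' s'
  | ite_false {b p q v s n v' s'} (hb : b v = false) (h : Exec q v s n v' s') :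
      Exec (ite b p q) v s (n + 1) v' s'
  | loop_false {b p v s} (hb : b v = false) : Exec (loop b p) v s 1 v s
  | loop_true {b p v s n v' s' m v'' s''} (hb : b v = true) (h : Exec p v s n v' s')
      (h' : Exec (loop b p) v' s' m v'' s'') : Exec (loop b p) v s (n + m + 1) v'' s''
  | mono {p v s n m v' s'} (h : Exec p v s n v' s') (hn : n ≤ m) : Exec p v s m v' s'

/-- `Within M c n c'`: the machine `M` gets from `c` to `c'` in at most `n` steps. -/
def Within {Λ : Type} (M : Λ → TM2.Stmt Γ Λ σ) (c : TM2.Cfg Γ Λ σ) (n : ℕ)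
    (c' : TM2.Cfg Γ Λ σ) : Prop :=
  Nonempty (StateTransition.EvalsToInTime (TM2.step M) c (some c') n)

theorem Within.trans {Λ : Type} {M : Λ → TM2.Stmt Γ Λ σ} {c c' c'' : TM2.Cfg Γ Λ σ} {n m : ℕ}
    (h : Within M c n c') (h' : Within M c' m c'') : Within M c (n + m) c'' := by
  obtain ⟨h⟩ := h
  obtain ⟨h'⟩ := h'
  exact ⟨add_comm n m ▸ StateTransition.EvalsToInTime.trans _ _ _ _ _ _ h h'⟩

theorem Within.mono {Λ : Type} {M : Λ → TM2.Stmt Γ Λ σ} {c c' : TM2.Cfg Γ Λ σ} {n m : ℕ}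
    (h : Within M c n c') (hn : n ≤ m) : Within M c m c' := by
  obtain ⟨h⟩ := h
  exact ⟨⟨h.toEvalsTo, h.steps_le_m.trans hn⟩⟩

theorem Within.single {Λ : Type} {M : Λ → TM2.Stmt Γ Λ σ} {l : Λ} {q : TM2.Stmt Γ Λ σ}
    {v : σ} {s : ∀ k, List (Γ k)} {c : TM2.Cfg Γ Λ σ} (h : M l = q)
    (hc : TM2.stepAux q v s = c) : Within M ⟨some l, v, s⟩ 1 c :=
  ⟨⟨⟨1, by subst h hc; rfl⟩, le_rfl⟩⟩

/-- The machine code of a program does what the program does. -/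
theorem Exec.within {Λ : Type} {M : Λ → TM2.Stmt Γ Λ σ} {p : Prog Γ σ} {v v' : σ}
    {s s' : ∀ k, List (Γ k)} {n : ℕ} (h : Exec p v s n v' s') (i : p.Lab → Λ) (e : Λ)
    (hM : ∀ l, M (i l) = p.code i e l) :
    Within M ⟨some (i p.entry), v, s⟩ n ⟨some e, v', s'⟩ := by
  -- Embedding and exit label must both vary: a subprogram is embedded through its summand and exits
  -- to the label at which execution continues.
  induction h generalizing e with
  | push => exact .single (hM ()) rfl
  | pop => exact .single (hM ()) rfl
  | load => exact .single (hM ()) rfl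
  | seq _ _ ih ih' =>
    exact (ih (fun x => i (Sum.inl x)) _ fun l => hM (Sum.inl l)).trans
      (ih' (fun x => i (Sum.inr x)) _ fun l => hM (Sum.inr l))
  | ite_true hb _ ih =>
    rw [add_comm]
    exact (Within.single (hM none) (congrArg (cond · _ _) hb)).trans
      (ih (fun x => i (some (Sum.inl x))) _ fun l => hM (some (Sum.inl l)))
  | ite_false hb _ ih =>
    rw [add_comm]
    exact (Within.single (hM none) (congrArg (cond · _ _) hb)).trans
      (ih (fun x => i (some (Sum.inr x))) _ fun l => hM (some (Sum.inr l)))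
  | loop_false hb => exact .single (hM none) (congrArg (cond · _ _) hb)
  | @loop_true b p v s n v' s' m v'' s'' hb _ _ ih ih' =>
    rw [add_comm (n + m)]
    exact (Within.single (hM none) (congrArg (cond · _ _) hb)).trans
      ((ih (fun x => i (some x)) _ fun l => hM (some l)).trans (ih' i e hM))
  | mono _ hn ih => exact (ih i e hM).mono hn

end Prog

/-! ### Binary trees and elementary programs on stacks of trees -/

/-- Binary trees, the universal data type for polynomial time computations. -/
inductive BTree where
  | nil
  | node (a b : BTree)

namespace BTree

/-- The number of nodes and leaves. -/
def size : BTree → ℕ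
  | nil => 1
  | node a b => a.size + b.size + 1

/-- The preorder code. -/
def code : BTree → List Bool
  | nil => [false]
  | node a b => true :: (a.code ++ b.code)

/-- The left subtree. -/
def fst : BTree → BTree
  | nil => nil
  | node a _ => a

/-- The right subtree. -/
def snd : BTree → BTree
  | nil => nil
  | node _ b => b

/-- Is the tree `nil`? -/
def isNil : BTree → Bool
  | nil => true
  | node _ _ => false

theorem one_le_size : ∀ t : BTree, 1 ≤ t.size
  | nil => le_rfl
  | node _ _ => Nat.le_add_left _ _

@[simp] theorem length_code : ∀ t : BTree, t.code.length = t.size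
  | nil => rfl
  | node a b => by simp [code, size, length_code a, length_code b]

end BTree

/-- The stacks of the tree machine. -/
inductive Stk where
  | inp | main | left | right | depth | out
  deriving DecidableEq

instance : Fintype Stk :=
  ⟨{.inp, .main, .left, .right, .depth, .out}, fun k => by cases k <;> decide⟩

/-- The alphabets of the stacks of the tree machine. -/
abbrev StkLetter (L : Type) : Stk → Type
  | .inp => L
  | _ => Bool

/-- The register of the tree machine. -/
abbrev Reg (L : Type) : Type := Option Bool × Option L

/-- Stack contents, listed. -/
def stk {L : Type} (i : List L) (a b c d o : List Bool) : ∀ k, List (StkLetter L k)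
  | .inp => i
  | .main => a
  | .left => b
  | .right => c
  | .depth => d
  | .out => o

/-- Programs of the tree machine. -/
abbrev TreeProg (L : Type) : Type := Prog (StkLetter L) (Reg L)

namespace TreeProg

open Prog

variable {L : Type}

/-- The empty register. -/
def empty : Reg L := (none, none)

/-- The register that holds `x`. -/
def flag (x : Option Bool) : Reg L := (x, none)

/-- The new stacks are given up to an equation, so that the instances below can present them again
in the form `stk`. -/
theorem exec_push {k : Stk} {f : Reg L → StkLetter L k} {v : Reg L}
    {s s' : ∀ k, List (StkLetter L k)} (h : update s k (f v :: s k) = s') :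
    Exec (push k f) v s 1 v s' := h ▸ .push

theorem exec_pop {k : Stk} {f : Reg L → Option (StkLetter L k) → Reg L} {v : Reg L}
    {s s' : ∀ k, List (StkLetter L k)} (h : update s k (s k).tail = s') :
    Exec (pop k f) v s 1 (f v (s k).head?) s' := h ▸ .pop

variable {i : List L} {a b c d o : List Bool} {v : Reg L}

theorem exec_push_main {f : Reg L → Bool} :
    Exec (push .main f) v (stk i a b c d o) 1 v (stk i (f v :: a) b c d o) :=
  exec_push (by funext k; cases k <;> rfl)

theorem exec_push_left {f : Reg L → Bool} :
    Exec (push .left f) v (stk i a b c d o) 1 v (stk i a (f v :: b) c d o) :=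
  exec_push (by funext k; cases k <;> rfl)

theorem exec_push_right {f : Reg L → Bool} :
    Exec (push .right f) v (stk i a b c d o) 1 v (stk i a b (f v :: c) d o) :=
  exec_push (by funext k; cases k <;> rfl)

theorem exec_push_depth {f : Reg L → Bool} :
    Exec (push .depth f) v (stk i a b c d o) 1 v (stk i a b c (f v :: d) o) :=
  exec_push (by funext k; cases k <;> rfl)

theorem exec_push_out {f : Reg L → Bool} :
    Exec (push .out f) v (stk i a b c d o) 1 v (stk i a b c d (f v :: o)) :=
  exec_push (by funext k; cases k <;> rfl)

/-- Pop a letter into the register. -/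
def get (k : Stk) (h : StkLetter L k = Bool) : TreeProg L :=
  .pop k fun _ x => (h ▸ x, none)

theorem exec_get_main :
    Exec (get .main rfl) v (stk i a b c d o) 1 (flag a.head?) (stk i a.tail b c d o) :=
  exec_pop (by funext k; cases k <;> rfl)

theorem exec_get_left :
    Exec (get .left rfl) v (stk i a b c d o) 1 (flag b.head?) (stk i a b.tail c d o) :=
  exec_pop (by funext k; cases k <;> rfl)

theorem exec_get_right :
    Exec (get .right rfl) v (stk i a b c d o) 1 (flag c.head?) (stk i a b c.tail d o) :=
  exec_pop (by funext k; cases k <;> rfl)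

theorem exec_get_depth :
    Exec (get .depth rfl) v (stk i a b c d o) 1 (flag d.head?) (stk i a b c d.tail o) :=
  exec_pop (by funext k; cases k <;> rfl)

/-- The letter in the register. -/
def letter (v : Reg L) : Bool := v.1.getD false

/-- Does the register hold a letter? -/
def full (v : Reg L) : Bool := v.1.isSome

/-- The program that does nothing. -/
def skip : TreeProg L := .load id

theorem exec_skip {s : ∀ k, List (StkLetter L k)} : Exec skip v s 1 v s := .load

/-- Clear the register. -/
def clear : TreeProg L := .load fun _ => empty

theorem exec_clear {s : ∀ k, List (StkLetter L k)} : Exec clear v s 1 empty s := .load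

/-- One step of `take`. -/
def takeBody (tl tr : Bool) : TreeProg L :=
  .seq (get .main rfl) (.seq (if tl then .push .left letter else skip)
    (.seq (if tr then .push .right letter else skip)
      (.seq (.ite letter (.seq (.push .depth fun _ => true) (.push .depth fun _ => true)) skip)
        (get .depth rfl))))

/-- Remove a tree from the main stack, and put its reversed code on the stacks `left` (if `tl`)
and `right` (if `tr`). -/
def take (tl tr : Bool) : TreeProg L :=
  -- Register and `depth` together count in unary the trees still to be read: each letter uses up
  -- one, and `true` announces two more. The count reaches zero exactly at the end of the tree. The
  -- initial push and pop set it to one.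
  .seq (.push .depth fun _ => true) (.seq (get .depth rfl) (.loop full (takeBody tl tr)))

theorem exec_takeBody (tl tr : Bool) (x : Bool) :
    Exec (takeBody tl tr) v (stk i (x :: a) b c d o) 10
      (flag (if x then true :: true :: d else d).head?)
      (stk i a (if tl then x :: b else b) (if tr then x :: c else c)
        (if x then true :: true :: d else d).tail o) := by
  have h1 : Exec (if tl then .push .left letter else skip) (flag (some x)) (stk i a b c d o) 1
      (flag (some x)) (stk i a (if tl then x :: b else b) c d o) := by
    cases tl
    · exact exec_skip
    · exact exec_push_left
  generalize (if tl then x :: b else b) = b' at *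
  have h2 : Exec (if tr then .push .right letter else skip) (flag (some x)) (stk i a b' c d o) 1
      (flag (some x)) (stk i a b' (if tr then x :: c else c) d o) := by
    cases tr
    · exact exec_skip
    · exact exec_push_right
  generalize (if tr then x :: c else c) = c' at *
  have h3 : Exec (.ite letter (.seq (.push .depth fun _ => true) (.push .depth fun _ => true)) skip)
      (flag (some x)) (stk i a b' c' d o) 3 (flag (some x))
      (stk i a b' c' (if x then true :: true :: d else d) o) := by
    cases x
    · exact .mono (.ite_false rfl exec_skip) (by omega)
    · exact .ite_true rfl (.seq exec_push_depth exec_push_depth)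
  exact .mono (.seq exec_get_main (.seq h1 (.seq h2 (.seq h3 exec_get_depth)))) (by omega)

/-- The rest of the run, after `t` has been read, is a hypothesis; this makes induction on `t`
possible. At a node, the left subtree is read with one more entry on `depth`, which then starts the
right subtree. Each letter costs 10 steps and one loop test. -/
theorem exec_take_loop (tl tr : Bool) (t : BTree) {n : ℕ} {v' : Reg L}
    {s' : ∀ k, List (StkLetter L k)}
    (h : Exec (.loop full (takeBody tl tr)) (flag d.head?)
      (stk i a (if tl then t.code.reverse ++ b else b) (if tr then t.code.reverse ++ c else c)
        d.tail o) n v' s') :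
    Exec (.loop full (takeBody tl tr)) (flag (some true)) (stk i (t.code ++ a) b c d o)
      (n + 11 * t.size) v' s' := by
  induction t generalizing a b c d n with
  | nil =>
    refine .mono (.loop_true rfl (exec_takeBody tl tr false) ?_)
      (show 10 + n + 1 ≤ _ by simp [BTree.size]; omega)
    simpa [BTree.code] using h
  | node t u iht ihu =>
    refine .mono (.loop_true rfl (exec_takeBody tl tr true) ?_)
      (show 10 + (n + 11 * u.size + 11 * t.size) + 1 ≤ _ by simp [BTree.size]; omega)
    rw [List.append_eq, List.append_assoc]
    refine iht (d := true :: d) (ihu ?_)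
    cases tl <;> cases tr <;> simpa [BTree.code] using h

theorem exec_take (tl tr : Bool) (t : BTree) :
    Exec (take tl tr) v (stk i (t.code ++ a) b c [] o) (11 * t.size + 3) empty
      (stk i a (if tl then t.code.reverse ++ b else b) (if tr then t.code.reverse ++ c else c)
        [] o) :=
  .mono (.seq exec_push_depth (.seq exec_get_depth (exec_take_loop tl tr t (.loop_false rfl))))
    (by omega)

/-- Move the stack `left` to the main stack. -/
def unloadLeft : TreeProg L :=
  .seq (get .left rfl) (.loop full (.seq (.push .main letter) (get .left rfl)))

theorem exec_unloadLeft (w : List Bool) :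
    Exec unloadLeft v (stk i a w.reverse c d o) (3 * w.length + 2) empty
      (stk i (w ++ a) [] c d o) := by
  suffices h : ∀ (w a : List Bool), Exec unloadLeft v (stk i a w c d o) (3 * w.length + 2) empty
      (stk i (w.reverse ++ a) [] c d o) by
    simpa using h w.reverse a
  intro w a
  refine .mono (.seq exec_get_left (m := 3 * w.length + 1) ?_) (by omega)
  induction w generalizing a with
  | nil => exact .loop_false rfl
  | cons x w ih =>
    rw [List.reverse_cons, List.append_assoc]
    refine .mono (.loop_true rfl (.seq exec_push_main exec_get_left) (ih (x :: a))) ?_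
    simp only [List.length_cons]
    omega

/-- Move the stack `right` to the main stack. -/
def unloadRight : TreeProg L :=
  .seq (get .right rfl) (.loop full (.seq (.push .main letter) (get .right rfl)))

theorem exec_unloadRight (w : List Bool) :
    Exec unloadRight v (stk i a b w.reverse d o) (3 * w.length + 2) empty
      (stk i (w ++ a) b [] d o) := by
  suffices h : ∀ (w a : List Bool), Exec unloadRight v (stk i a b w d o) (3 * w.length + 2) empty
      (stk i (w.reverse ++ a) b [] d o) by
    simpa using h w.reverse a
  intro w a
  refine .mono (.seq exec_get_right (m := 3 * w.length + 1) ?_) (by omega)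
  induction w generalizing a with
  | nil => exact .loop_false rfl
  | cons x w ih =>
    rw [List.reverse_cons, List.append_assoc]
    refine .mono (.loop_true rfl (.seq exec_push_main exec_get_right) (ih (x :: a))) ?_
    simp only [List.length_cons]
    omega

/-- Remove the top tree. -/
def drop : TreeProg L := take false false

theorem exec_drop (t : BTree) :
    Exec drop v (stk i (t.code ++ a) b c [] o) (11 * t.size + 3) empty (stk i a b c [] o) :=
  exec_take false false t

/-- Duplicate the top tree. -/
def dup : TreeProg L := .seq (take true true) (.seq unloadLeft unloadRight)

theorem exec_dup (t : BTree) :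
    Exec dup v (stk i (t.code ++ a) [] [] [] o) (17 * t.size + 7) empty
      (stk i (t.code ++ (t.code ++ a)) [] [] [] o) := by
  have h := exec_take (v := v) (i := i) (a := a) (b := []) (c := []) (o := o) true true t
  simp only [if_true, List.append_nil] at h
  refine .mono (.seq h (.seq (exec_unloadLeft _) (exec_unloadRight _))) ?_
  rw [BTree.length_code]
  omega

/-- Exchange the two top trees. -/
def swap : TreeProg L :=
  .seq (take true false) (.seq (take false true) (.seq unloadLeft unloadRight))

theorem exec_swap (t u : BTree) :
    Exec swap v (stk i (t.code ++ (u.code ++ a)) [] [] [] o) (14 * t.size + 14 * u.size + 10) empty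
      (stk i (u.code ++ (t.code ++ a)) [] [] [] o) := by
  have h := exec_take (v := v) (i := i) (a := u.code ++ a) (b := []) (c := []) (o := o) true false t
  have h' := exec_take (v := empty) (i := i) (a := a) (b := t.code.reverse) (c := []) (o := o)
    false true u
  simp only [if_true, List.append_nil, Bool.false_eq_true, if_false] at h h'
  refine .mono (.seq h (.seq h' (.seq (exec_unloadLeft _) (exec_unloadRight _)))) ?_
  rw [BTree.length_code, BTree.length_code]
  omega

/-- Replace the top tree by its left subtree. -/
def left : TreeProg L :=
  .seq (get .main rfl) (.ite letter (.seq (take true false) (.seq drop unloadLeft))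
    (.seq (.push .main fun _ => false) clear))

theorem exec_left (t : BTree) :
    Exec left v (stk i (t.code ++ a) [] [] [] o) (14 * t.size + 20) empty
      (stk i (t.fst.code ++ a) [] [] [] o) := by
  cases t with
  | nil =>
    exact .mono (.seq exec_get_main (.ite_false rfl (.seq exec_push_main exec_clear))) (by omega)
  | node t u =>
    have h := exec_take (v := flag (some true)) (i := i) (a := u.code ++ a) (b := []) (c := [])
      (o := o) true false t
    simp only [if_true, List.append_nil, Bool.false_eq_true, if_false] at h
    simp only [BTree.code, List.cons_append, List.append_assoc, BTree.fst]
    refine .mono (.seq exec_get_main (.ite_true rfl (.seq h (.seq (exec_drop u)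
      (exec_unloadLeft _))))) ?_
    rw [BTree.length_code, BTree.size]
    omega

/-- Replace the top tree by its right subtree. -/
def right : TreeProg L :=
  .seq (get .main rfl) (.ite letter drop (.seq (.push .main fun _ => false) clear))

theorem exec_right (t : BTree) :
    Exec right v (stk i (t.code ++ a) [] [] [] o) (14 * t.size + 20) empty
      (stk i (t.snd.code ++ a) [] [] [] o) := by
  cases t with
  | nil =>
    exact .mono (.seq exec_get_main (.ite_false rfl (.seq exec_push_main exec_clear))) (by omega)
  | node t u =>
    simp only [BTree.code, List.cons_append, List.append_assoc, BTree.snd]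
    refine .mono (.seq exec_get_main (.ite_true rfl (exec_drop t))) ?_
    rw [BTree.size]
    omega

/-- Remove the top tree, and branch according to whether it is `nil` or not. -/
def branch (p q : TreeProg L) : TreeProg L :=
  -- The letter of a node is put back because `drop` removes complete trees only.
  .seq (get .main rfl) (.ite letter (.seq (.push .main fun _ => true) (.seq drop p))
    (.seq clear q))

theorem exec_branch_nil {p q : TreeProg L} {n : ℕ} {v' : Reg L} {s' : ∀ k, List (StkLetter L k)}
    (h : Exec q empty (stk i a b c [] o) n v' s') :
    Exec (branch p q) v (stk i (BTree.nil.code ++ a) b c [] o) (n + 3) v' s' :=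
  .mono (.seq exec_get_main (.ite_false rfl (.seq exec_clear h))) (by omega)

theorem exec_branch_node {p q : TreeProg L} {n : ℕ} {v' : Reg L} {s' : ∀ k, List (StkLetter L k)}
    {t u : BTree} (h : Exec p empty (stk i a b c [] o) n v' s') :
    Exec (branch p q) v (stk i ((BTree.node t u).code ++ a) b c [] o)
      (n + 11 * (BTree.node t u).size + 6) v' s' :=
  .mono (.seq exec_get_main (.ite_true rfl (.seq exec_push_main (.seq (exec_drop (.node t u)) h))))
    (by omega)

/-- Find out whether the left subtree of the top tree is `nil`. -/
def peek : TreeProg L :=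
  .seq (get .main rfl) (.ite letter
    (.seq (get .main rfl) (.seq (.push .main letter) (.push .main fun _ => true)))
    (.push .main letter))

theorem exec_peek_nil (u : BTree) :
    Exec peek v (stk i ((BTree.node .nil u).code ++ a) b c d o) 5 (flag (some false))
      (stk i ((BTree.node .nil u).code ++ a) b c d o) :=
  .mono (.seq exec_get_main (.ite_true rfl (.seq exec_get_main (.seq exec_push_main
    exec_push_main)))) (by omega)

theorem exec_peek_node (t t' u : BTree) :
    Exec peek v (stk i ((BTree.node (.node t t') u).code ++ a) b c d o) 5 (flag (some true))
      (stk i ((BTree.node (.node t t') u).code ++ a) b c d o) :=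
  .mono (.seq exec_get_main (.ite_true rfl (.seq exec_get_main (.seq exec_push_main
    exec_push_main)))) (by omega)

/-- Repeat `p` while the left subtree of the top tree is not `nil`. -/
def whileLeft (p : TreeProg L) : TreeProg L :=
  .seq peek (.seq (.loop letter (.seq clear (.seq p peek))) clear)

end TreeProg

/-! ### Polynomial time on trees: closure properties -/

/-- Used to substitute a size bound for an intermediate result into a time bound. -/
theorem Polynomial.eval_mono_nat (P : Polynomial ℕ) {m n : ℕ} (h : m ≤ n) :
    P.eval m ≤ P.eval n := by
  rw [Polynomial.eval_eq_sum_range, Polynomial.eval_eq_sum_range]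
  gcongr

/-- Types whose elements are represented by binary trees. -/
class TreeEncodable (α : Type) where
  enc : α → BTree

namespace TreeEncodable

instance : TreeEncodable BTree := ⟨id⟩

/-- The codes overlap on purpose: `false` and the empty list are both `nil`, and a nonempty list is
coded like the pair of its head and tail. Tests and list operations are thus operations on trees. -/
instance : TreeEncodable Bool := ⟨fun x => cond x (.node .nil .nil) .nil⟩

instance {α β : Type} [TreeEncodable α] [TreeEncodable β] : TreeEncodable (α × β) :=
  ⟨fun x => .node (enc x.1) (enc x.2)⟩

/-- The tree that represents a list. -/
def encList {α : Type} [TreeEncodable α] : List α → BTree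
  | [] => .nil
  | a :: l => .node (enc a) (encList l)

instance {α : Type} [TreeEncodable α] : TreeEncodable (List α) := ⟨encList⟩

/-- The size of the tree that represents `x`. -/
def size {α : Type} [TreeEncodable α] (x : α) : ℕ := (enc x).size

variable {α β : Type} [TreeEncodable α] [TreeEncodable β]

theorem one_le_size (x : α) : 1 ≤ size x := BTree.one_le_size _

theorem size_pair (x : α) (y : β) : size (x, y) = size x + size y + 1 := rfl

theorem size_nil : size ([] : List α) = 1 := rfl

theorem size_cons (x : α) (l : List α) : size (x :: l) = size x + size l + 1 := rfl

theorem size_bool_le (x : Bool) : size x ≤ 3 := by cases x <;> decide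

theorem length_lt_size (l : List α) : l.length < size l := by
  induction l with
  | nil => exact Nat.one_pos
  | cons x l ih => rw [size_cons, List.length_cons]; omega

theorem size_append (l l' : List α) : size (l ++ l') + 1 = size l + size l' := by
  induction l with
  | nil => rw [size_nil, List.nil_append, add_comm]
  | cons x l ih => rw [List.cons_append, size_cons, size_cons]; omega

theorem size_reverse (l : List α) : size l.reverse = size l := by
  induction l with
  | nil => rfl
  | cons x l ih =>
    have := size_append l.reverse [x]
    rw [List.reverse_cons, size_cons]
    rw [size_cons, size_nil] at this
    omega

theorem size_le_of_sublist {l l' : List α} (h : l.Sublist l') : size l ≤ size l' := by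
  induction h with
  | slnil => exact le_rfl
  | cons x _ ih => rw [size_cons]; omega
  | cons_cons x _ ih => rw [size_cons, size_cons]; omega

end TreeEncodable

open TreeEncodable TreeProg Prog

/-- The function `f` is computed in polynomial time by a program of the tree machine, which uses
the part of the main stack below its argument for nothing. -/
def TreePolyTime {α β : Type} [TreeEncodable α] [TreeEncodable β] (f : α → β) : Prop :=
  -- One polynomial bounds the time and also the size of the result, which compositions need. It is
  -- chosen before the input alphabet `L`, whose stack is already empty here.
  ∃ P : Polynomial ℕ, (∀ x, size (f x) ≤ P.eval (size x)) ∧ ∀ L : Type, ∃ p : TreeProg L, ∀ x a,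
    Exec p empty (stk [] ((enc x).code ++ a) [] [] [] []) (P.eval (size x)) empty
      (stk [] ((enc (f x)).code ++ a) [] [] [] [])

namespace TreePolyTime

variable {α β γ δ : Type} [TreeEncodable α] [TreeEncodable β] [TreeEncodable γ] [TreeEncodable δ]

/-- Programs see only codes, so a function that agrees with `f` on codes needs no new program. -/
theorem recode {f : α → β} (hf : TreePolyTime f) (φ : γ → α) {g : γ → δ}
    (h : ∀ x, enc (φ x) = enc x) (h' : ∀ x, enc (f (φ x)) = enc (g x)) : TreePolyTime g := by
  obtain ⟨P, hP, hp⟩ := hf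
  refine ⟨P, fun x => ?_, fun L => ?_⟩
  · have := hP (φ x)
    rwa [size, size, h, h'] at this
  · obtain ⟨p, hp⟩ := hp L
    refine ⟨p, fun x a => ?_⟩
    have := hp (φ x) a
    rwa [size, h, h'] at this

protected theorem id : TreePolyTime fun x : α => x :=
  ⟨.X + 1, fun x => by simp, fun L => ⟨skip, fun x a => .mono exec_skip (by simp)⟩⟩

theorem comp {g : β → γ} {f : α → β} (hg : TreePolyTime g) (hf : TreePolyTime f) :
    TreePolyTime fun x => g (f x) := by
  obtain ⟨P, hP, hp⟩ := hf
  obtain ⟨P', hP', hp'⟩ := hg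
  refine ⟨P + P'.comp P, fun x => ?_, fun L => ?_⟩
  · have := (hP' (f x)).trans (P'.eval_mono_nat (hP x))
    simp only [Polynomial.eval_add, Polynomial.eval_comp]
    omega
  · obtain ⟨p, hp⟩ := hp L
    obtain ⟨p', hp'⟩ := hp' L
    refine ⟨.seq p p', fun x a => .mono (.seq (hp x a) (hp' (f x) a)) ?_⟩
    have := P'.eval_mono_nat (hP x)
    simp only [Polynomial.eval_add, Polynomial.eval_comp]
    omega

theorem pair {f : α → β} {g : α → γ} (hf : TreePolyTime f) (hg : TreePolyTime g) :
    TreePolyTime fun x => (f x, g x) := by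
  obtain ⟨P, hP, hp⟩ := hf
  obtain ⟨P', hP', hp'⟩ := hg
  refine ⟨P + 15 * P' + 31 * .X + 20, fun x => ?_, fun L => ?_⟩
  · have h := hP x
    have h' := hP' x
    rw [size_pair]
    simp
    omega
  · obtain ⟨p, hp⟩ := hp L
    obtain ⟨p', hp'⟩ := hp' L
    -- `g` is computed first, so that after the exchange the value of `f` ends on top, where the
    -- letter of the root goes. The exchange costs 14 times both sizes, whence the factor 15 of
    -- `P'`.
    refine ⟨.seq dup (.seq p' (.seq swap (.seq p (.push .main fun _ => true)))), fun x a => ?_⟩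
    have key := Exec.seq (exec_dup (v := empty) (i := []) (a := a) (o := []) (enc x))
      (.seq (hp' x ((enc x).code ++ a)) (.seq (exec_swap (enc (g x)) (enc x))
        (.seq (hp x ((enc (g x)).code ++ a)) (exec_push_main (f := fun _ => true)))))
    have e : (enc (f x, g x)).code ++ a
        = true :: ((enc (f x)).code ++ ((enc (g x)).code ++ a)) := by
      simp [enc, BTree.code]
    rw [e]
    refine key.mono ?_
    have h' := hP' x
    simp [size] at *
    omega

theorem treeFst : TreePolyTime BTree.fst := by
  refine ⟨14 * .X + 20, fun t => ?_, fun L => ⟨left, fun t a => .mono (exec_left t) ?_⟩⟩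
  · cases t <;> simp [size, enc, BTree.fst, BTree.size]; omega
  · simp [size, enc]

theorem treeSnd : TreePolyTime BTree.snd := by
  refine ⟨14 * .X + 20, fun t => ?_, fun L => ⟨right, fun t a => .mono (exec_right t) ?_⟩⟩
  · cases t <;> simp [size, enc, BTree.snd, BTree.size]; omega
  · simp [size, enc]

theorem fst' : TreePolyTime (Prod.fst : α × β → α) := treeFst.recode enc (fun _ => rfl) fun _ => rfl

theorem snd' : TreePolyTime (Prod.snd : α × β → β) := treeSnd.recode enc (fun _ => rfl) fun _ => rfl

theorem fst {f : α → β × γ} (hf : TreePolyTime f) : TreePolyTime fun x => (f x).1 := fst'.comp hf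

theorem snd {f : α → β × γ} (hf : TreePolyTime f) : TreePolyTime fun x => (f x).2 := snd'.comp hf

theorem const (y : β) : TreePolyTime fun _ : α => y := by
  suffices h : ∀ t : BTree, TreePolyTime fun _ : α => t from
    (h (enc y)).recode id (fun _ => rfl) fun _ => rfl
  intro t
  induction t with
  | nil =>
    refine ⟨11 * .X + 4, fun x => ?_, fun L => ⟨.seq drop (.push .main fun _ => false),
      fun x a => .mono (.seq (exec_drop _) exec_push_main) ?_⟩⟩
    · have := one_le_size x
      simp [size, enc, BTree.size] at *
    · simp [size]
  | node t u iht ihu => exact (iht.pair ihu).recode id (fun _ => rfl) fun _ => rfl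

protected theorem cond {c : α → Bool} {f g : α → β} (hc : TreePolyTime c) (hf : TreePolyTime f)
    (hg : TreePolyTime g) : TreePolyTime fun x => cond (c x) (f x) (g x) := by
  obtain ⟨C, hC, hc⟩ := hc
  obtain ⟨P, hP, hp⟩ := hf
  obtain ⟨P', hP', hp'⟩ := hg
  refine ⟨C + P + P' + 17 * .X + 50, fun x => ?_, fun L => ?_⟩
  · have h := hP x
    have h' := hP' x
    simp only [Polynomial.eval_add]
    cases c x <;> simp only [cond_true, cond_false] <;> omega
  · obtain ⟨c', hc⟩ := hc L
    obtain ⟨p, hp⟩ := hp L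
    obtain ⟨p', hp'⟩ := hp' L
    refine ⟨.seq dup (.seq c' (branch p p')), fun x a => ?_⟩
    have key := fun {n v' s'} h => Exec.seq
      (exec_dup (v := empty) (i := []) (a := a) (o := []) (enc x))
        (.seq (hc x ((enc x).code ++ a)) (q := branch p p') (m := n) (v'' := v') (s'' := s') h)
    cases hcx : c x with
    | false =>
      rw [hcx] at key
      simp only [hcx, cond_false]
      refine (key (exec_branch_nil (hp' x a))).mono ?_
      simp [size]
      omega
    | true =>
      rw [hcx] at key
      simp only [hcx, cond_true]
      refine (key (exec_branch_node (hp x a))).mono ?_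
      simp [size, BTree.size]
      omega

theorem and {p q : α → Bool} (hp : TreePolyTime p) (hq : TreePolyTime q) :
    TreePolyTime fun x => p x && q x :=
  (hp.cond hq (const false)).recode id (fun _ => rfl) fun x => by cases h : p x <;> simp [h]

theorem or {p q : α → Bool} (hp : TreePolyTime p) (hq : TreePolyTime q) :
    TreePolyTime fun x => p x || q x :=
  (hp.cond (const true) hq).recode id (fun _ => rfl) fun x => by cases h : p x <;> simp [h]

theorem not {p : α → Bool} (hp : TreePolyTime p) : TreePolyTime fun x => !p x :=
  (hp.cond (const false) (const true)).recode id (fun _ => rfl) fun x => by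
    cases h : p x <;> simp [h]

theorem beqBool {p q : α → Bool} (hp : TreePolyTime p) (hq : TreePolyTime q) :
    TreePolyTime fun x => p x == q x :=
  (hp.cond hq hq.not).recode id (fun _ => rfl) fun x => by cases h : p x <;> simp [h]

theorem cons {f : α → β} {g : α → List β} (hf : TreePolyTime f) (hg : TreePolyTime g) :
    TreePolyTime fun x => f x :: g x :=
  (hf.pair hg).recode id (fun _ => rfl) fun _ => rfl

theorem tail {f : α → List β} (hf : TreePolyTime f) : TreePolyTime fun x => (f x).tail :=
  (treeSnd.recode (g := List.tail) enc (fun _ => rfl) fun l => by cases l <;> rfl).comp hf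

/-- The left subtree of `nil` is `nil`, so the default value must have the code `nil`. -/
theorem headD {d : β} (hd : enc d = .nil) {f : α → List β} (hf : TreePolyTime f) :
    TreePolyTime fun x => (f x).headD d :=
  (treeFst.recode (g := fun l : List β => l.headD d) enc (fun _ => rfl) fun l => by
    cases l
    · exact hd.symm
    · rfl).comp hf

theorem isEmpty {f : α → List β} (hf : TreePolyTime f) : TreePolyTime fun x => (f x).isEmpty := by
  have h : TreePolyTime BTree.isNil := by
    refine ⟨11 * .X + 50, fun t => ?_, fun L => ⟨branch (.push .main fun _ => false)
      -- The code of `true`, which is `[true, false, false]`, is pushed from its end.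
      (.seq (.push .main fun _ => false) (.seq (.push .main fun _ => false)
        (.push .main fun _ => true))), fun t a => ?_⟩⟩
    · have := size_bool_le t.isNil
      simp
      omega
    · cases t with
      | nil =>
        exact .mono (exec_branch_nil (.seq exec_push_main (.seq exec_push_main exec_push_main)))
          (by simp)
      | node t u => exact .mono (exec_branch_node exec_push_main) (by simp [size, enc]; omega)
  exact (h.recode (g := fun l : List β => l.isEmpty) enc (fun _ => rfl)
    fun l => by cases l <;> rfl).comp hf

/-- Iteration along a list is possible in polynomial time if the sizes of all intermediate results
are bounded by a polynomial. -/
theorem foldl {l : α → List β} {s : α → γ} {f : α × β × γ → γ} (hl : TreePolyTime l)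
    (hs : TreePolyTime s) (hf : TreePolyTime f)
    (hb : ∃ B : Polynomial ℕ, ∀ x m, m <+: l x →
      size (m.foldl (fun y b => f (x, b, y)) (s x)) ≤ B.eval (size x)) :
    TreePolyTime fun x => (l x).foldl (fun y b => f (x, b, y)) (s x) := by
  -- The loop state is the remaining list, the argument `x` and the accumulator. One round starts
  -- with a nonempty remaining list, regarded as the pair of its head and tail.
  have hbody : TreePolyTime fun z : (β × List β) × α × γ =>
      (z.1.2, (z.2.1, f (z.2.1, z.1.1, z.2.2))) :=
    fst'.snd.pair (snd'.fst.pair (hf.comp (snd'.fst.pair (fst'.fst.pair snd'.snd))))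
  have hinit : TreePolyTime fun x => (l x, (x, s x)) := hl.pair (TreePolyTime.id.pair hs)
  have hwhile : ∃ R : Polynomial ℕ, ∀ L : Type, ∃ p : TreeProg L, ∀ x a,
      Exec p empty (stk [] ((enc (l x, (x, s x))).code ++ a) [] [] [] [])
        (R.eval (size x)) empty
        (stk [] ((enc (([] : List β), (x, (l x).foldl (fun y b => f (x, b, y)) (s x)))).code ++ a)
          [] [] [] []) := by
    obtain ⟨P, -, hp⟩ := hbody
    obtain ⟨Q, hQ, -⟩ := hl
    obtain ⟨B, hB⟩ := hb
    refine ⟨Q * (P.comp (Q + .X + B + 2) + 7) + 7, fun L => ?_⟩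
    obtain ⟨p, hp⟩ := hp L
    refine ⟨whileLeft p, fun x a => ?_⟩
    -- The time of one round: the remaining list has size at most `Q`, the accumulator at most `B`
    -- since it comes from a prefix of `l x`, and 2 counts the nodes that pair them with `x`. The
    -- additional 7 below are clearing, `peek` and the loop test.
    set N := P.eval (Q.eval (size x) + size x + B.eval (size x) + 2) with hN
    have hpeek : ∀ (r : List β) (z : α × γ) (v : Reg L), Exec peek v
        (stk [] ((enc (r, z)).code ++ a) [] [] [] []) 5 (flag (some !r.isEmpty))
        (stk [] ((enc (r, z)).code ++ a) [] [] [] []) := by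
      intro r z v
      cases r
      · exact exec_peek_nil _
      · exact exec_peek_node _ _ _
    have hloop : ∀ (r m : List β), m ++ r = l x →
        Exec (.loop letter (.seq clear (.seq p peek))) (flag (some !r.isEmpty))
          (stk [] ((enc (r, (x, m.foldl (fun y b => f (x, b, y)) (s x)))).code ++ a) [] [] [] [])
          (r.length * (N + 7) + 1) (flag (some false))
          (stk [] ((enc (([] : List β), (x, (l x).foldl (fun y b => f (x, b, y)) (s x)))).code ++ a)
            [] [] [] []) := by
      intro r
      induction r with
      | nil =>
        intro m hm
        rw [List.append_nil] at hm
        rw [hm]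
        exact .mono (.loop_false rfl) (by omega)
      | cons b r ih =>
        intro m hm
        have ih := ih (m ++ [b]) (by simpa using hm)
        rw [List.foldl_append] at ih
        have hp := hp ((b, r), (x, m.foldl (fun y b => f (x, b, y)) (s x))) a
        have hsz : P.eval (size ((b, r), (x, m.foldl (fun y b => f (x, b, y)) (s x)))) ≤ N := by
          refine P.eval_mono_nat ?_
          have h1 := hB x m ⟨_, hm⟩
          have h2 := hQ x
          have h3 : size (b :: r) ≤ size (l x) :=
            size_le_of_sublist (hm ▸ List.sublist_append_right _ _)
          rw [size_cons] at h3
          simp only [size_pair]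
          omega
        refine .mono (.loop_true rfl (.seq exec_clear (.seq hp (hpeek _ _ _))) ih) ?_
        rw [List.length_cons, Nat.add_one_mul]
        omega
    refine .mono (.seq (hpeek _ _ _) (.seq (hloop (l x) [] rfl) exec_clear)) ?_
    have h1 := (length_lt_size (l x)).le.trans (hQ x)
    have h2 := Nat.mul_le_mul_right (N + 7) h1
    simp only [Polynomial.eval_add, Polynomial.eval_mul, Polynomial.eval_comp, Polynomial.eval_X,
      Polynomial.eval_ofNat] at hN ⊢
    rw [← hN]
    omega
  obtain ⟨I, hI, hi⟩ := hinit
  obtain ⟨R, hR⟩ := hwhile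
  obtain ⟨B, hB⟩ := hb
  have hread : TreePolyTime fun x =>
      (([] : List β), (x, (l x).foldl (fun y b => f (x, b, y)) (s x))) := by
    refine ⟨I + R + .X + B + 3, fun x => ?_, fun L => ?_⟩
    · have := hB x (l x) (List.prefix_refl _)
      simp [size_pair, size_nil]
      omega
    · obtain ⟨p, hp⟩ := hi L
      obtain ⟨q, hq⟩ := hR L
      refine ⟨.seq p q, fun x a => .mono (.seq (hp x a) (hq x a)) ?_⟩
      simp
      omega
  exact hread.snd.snd

end TreePolyTime

/-! ### Polynomial time operations on lists, and equality tests -/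

namespace TreePolyTime

variable {α β γ δ : Type} [TreeEncodable α] [TreeEncodable β] [TreeEncodable γ] [TreeEncodable δ]

theorem any {l : α → List β} {p : α × β → Bool} (hl : TreePolyTime l) (hp : TreePolyTime p) :
    TreePolyTime fun x => (l x).any fun b => p (x, b) := by
  have h := foldl (s := fun _ => false) (f := fun z : α × β × Bool => z.2.2 || p (z.1, z.2.1)) hl
    (const false) (or snd'.snd (hp.comp (fst'.pair snd'.fst)))
    ⟨3, fun x m _ => (size_bool_le _).trans_eq (by simp)⟩
  refine h.recode id (fun _ => rfl) fun x => ?_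
  congr 1
  have (c : Bool) (m : List β) :
      m.foldl (fun y b => y || p (x, b)) c = (c || m.any fun b => p (x, b)) := by
    induction m generalizing c with
    | nil => simp
    | cons b m ih => rw [List.foldl_cons, ih, List.any_cons, Bool.or_assoc]
  exact this false (l x)

theorem reverse {l : α → List β} (hl : TreePolyTime l) : TreePolyTime fun x => (l x).reverse := by
  have h : TreePolyTime fun m : List β => m.reverse := by
    have hf (m : List β) : m.foldl (fun y b => b :: y) [] = m.reverse := by
      simp
    refine (foldl (l := fun m : List β => m) (s := fun _ => [])
      (f := fun z : List β × β × List β => z.2.1 :: z.2.2) .id (const [])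
      (cons snd'.fst snd'.snd) ⟨.X, fun x m hm => ?_⟩).recode id (fun _ => rfl)
        fun m => congrArg enc (hf m)
    rw [hf, size_reverse, Polynomial.eval_X]
    exact size_le_of_sublist hm.sublist
  exact h.comp hl

theorem filter {l : α → List β} {p : α × β → Bool} (hl : TreePolyTime l) (hp : TreePolyTime p) :
    TreePolyTime fun x => (l x).filter fun b => p (x, b) := by
  have hf (x : α) (m c : List β) : m.foldl (fun y b => cond (p (x, b)) (b :: y) y) c
      = (m.filter fun b => p (x, b)).reverse ++ c := by
    induction m generalizing c with
    | nil => rfl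
    | cons b m ih => rw [List.foldl_cons, ih, List.filter_cons]; cases p (x, b) <;> simp
  have h := foldl (s := fun _ => [])
    (f := fun z : α × β × List β => cond (p (z.1, z.2.1)) (z.2.1 :: z.2.2) z.2.2) hl (const [])
    ((hp.comp (fst'.pair snd'.fst)).cond (cons snd'.fst snd'.snd) snd'.snd) (by
      obtain ⟨Q, hQ, -⟩ := hl
      refine ⟨Q, fun x m hm => ?_⟩
      rw [hf, List.append_nil, size_reverse]
      exact (size_le_of_sublist (List.filter_sublist.trans hm.sublist)).trans (hQ x))
  refine h.reverse.recode id (fun _ => rfl) fun x => ?_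
  rw [id, hf, List.append_nil, List.reverse_reverse]

/-- A function that does not increase the size can be iterated. -/
theorem iterate {l : α → List β} {s : α → γ} {f : γ → γ} (hl : TreePolyTime l)
    (hs : TreePolyTime s) (hf : TreePolyTime f) (hle : ∀ y, size (f y) ≤ size y) :
    TreePolyTime fun x => f^[(l x).length] (s x) := by
  have hi (m : List β) (y : γ) : m.foldl (fun y _ => f y) y = f^[m.length] y := by
    induction m generalizing y with
    | nil => rfl
    | cons b m ih => rw [List.foldl_cons, ih]; rfl
  have hn (n : ℕ) (y : γ) : size (f^[n] y) ≤ size y := by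
    induction n generalizing y with
    | zero => exact le_rfl
    | succ n ih => exact (ih (f y)).trans (hle y)
  obtain ⟨Q, hQ, -⟩ := id hs
  refine (foldl (f := fun z : α × β × γ => f z.2.2) hl hs (hf.comp snd'.snd)
    ⟨Q, fun x m _ => ?_⟩).recode id (fun _ => rfl) fun x => congrArg enc (hi _ _)
  rw [hi]
  exact (hn _ _).trans (hQ x)

theorem getD {d : β} (hd : enc d = .nil) {l : α → List β} (hl : TreePolyTime l) (n : ℕ) :
    TreePolyTime fun x => (l x).getD n d := by
  induction n generalizing l with
  | zero => exact (headD hd hl).recode id (fun _ => rfl) fun x => by cases h : l x <;> simp [h]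
  | succ n ih =>
    exact (ih hl.tail).recode id (fun _ => rfl) fun x => by cases h : l x <;> simp [h]

/-- Here the list is fixed and unrolled into the program, whereas in `any` it is computed from the
argument. -/
theorem listAll {ι : Type} {p : ι → α → Bool} (l : List ι) (hp : ∀ i ∈ l, TreePolyTime (p i)) :
    TreePolyTime fun x => l.all fun i => p i x := by
  induction l with
  | nil => exact const true
  | cons i l ih =>
    exact and (hp i List.mem_cons_self) (ih fun j hj => hp j (List.mem_cons_of_mem i hj))

theorem listAny {ι : Type} {p : ι → α → Bool} (l : List ι) (hp : ∀ i ∈ l, TreePolyTime (p i)) :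
    TreePolyTime fun x => l.any fun i => p i x := by
  induction l with
  | nil => exact const false
  | cons i l ih =>
    exact or (hp i List.mem_cons_self) (ih fun j hj => hp j (List.mem_cons_of_mem i hj))

theorem listMap {ι : Type} {f : ι → α → β} (l : List ι) (hf : ∀ i ∈ l, TreePolyTime (f i)) :
    TreePolyTime fun x => l.map fun i => f i x := by
  induction l with
  | nil => exact const []
  | cons i l ih =>
    exact cons (hf i List.mem_cons_self) (ih fun j hj => hf j (List.mem_cons_of_mem i hj))

end TreePolyTime

/-- Types on which equality is decided in polynomial time. -/
class TreeDecidableEq (α : Type) [TreeEncodable α] [BEq α] : Prop where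
  beq : TreePolyTime fun x : α × α => x.1 == x.2

namespace TreePolyTime

variable {α β γ : Type} [TreeEncodable α] [TreeEncodable β] [TreeEncodable γ]

theorem beq [BEq β] [TreeDecidableEq β] {f g : α → β} (hf : TreePolyTime f) (hg : TreePolyTime g) :
    TreePolyTime fun x => f x == g x :=
  TreeDecidableEq.beq.comp (hf.pair hg)

instance : TreeDecidableEq Bool := ⟨beqBool fst' snd'⟩

instance [BEq α] [TreeDecidableEq α] [BEq β] [TreeDecidableEq β] : TreeDecidableEq (α × β) :=
  ⟨(beq fst'.fst snd'.fst).and (beq fst'.snd snd'.snd)⟩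

theorem beq_list [BEq α] [TreeDecidableEq α] {d : α} (hd : enc d = .nil) :
    TreeDecidableEq (List α) := by
  -- The state records whether all entries have agreed so far, and what is left of the second list.
  -- The emptiness test prevents a match with the default `d` beyond its end.
  let f : List α → Bool × List α → Bool × List α := fun m y =>
    m.foldl (fun y b => (!y.2.isEmpty && (b == y.2.headD d) && y.1, y.2.tail)) y
  have hf1 (m : List α) (y : Bool × List α) :
      ((f m y).1 && (f m y).2.isEmpty) = (y.1 && (m == y.2)) := by
    induction m generalizing y with
    | nil => obtain ⟨c, _ | ⟨b, l⟩⟩ := y <;> rfl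
    | cons b m ih =>
      refine (ih _).trans ?_
      obtain ⟨c, _ | ⟨b', l⟩⟩ := y
      · simp
      · simp only [List.isEmpty_cons, Bool.not_false, Bool.true_and, List.headD_cons,
          List.tail_cons, List.cons_beq_cons]
        cases c <;> cases b == b' <;> simp
  have hf2 (m : List α) (y : Bool × List α) : size (f m y).2 ≤ size y.2 := by
    induction m generalizing y with
    | nil => exact le_rfl
    | cons b m ih =>
      refine (ih _).trans ?_
      obtain ⟨c, _ | ⟨b', l⟩⟩ := y
      · exact le_rfl
      · simp only [List.tail_cons, size_cons]
        omega
  have h : TreePolyTime fun x : List α × List α => f x.1 (true, x.2) :=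
    foldl (f := fun z : (List α × List α) × α × Bool × List α =>
      (!z.2.2.2.isEmpty && (z.2.1 == z.2.2.2.headD d) && z.2.2.1, z.2.2.2.tail)) fst'
      ((const true).pair snd')
      (((snd'.snd.snd.isEmpty.not.and (beq snd'.fst (headD hd snd'.snd.snd))).and
        snd'.snd.fst).pair snd'.snd.snd.tail) ⟨.X + 5, fun x m _ => by
          have h1 := hf2 m (true, x.2)
          have h2 := size_bool_le (f m (true, x.2)).1
          change size (f m (true, x.2)) ≤ _
          rw [show size (f m (true, x.2)) = size (f m (true, x.2)).1 + size (f m (true, x.2)).2 + 1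
            from rfl]
          obtain ⟨x1, x2⟩ := x
          simp [size_pair] at *
          omega⟩
  exact ⟨(h.fst.and h.snd.isEmpty).recode id (fun _ => rfl) fun x =>
    congrArg enc ((hf1 _ _).trans (by simp))⟩

instance : TreeDecidableEq (List Bool) := beq_list (d := false) rfl

instance : TreeDecidableEq (List (List Bool)) := beq_list (d := []) rfl

end TreePolyTime

/-! ### Input, output and the Turing machine -/

namespace TreeProg

variable {L : Type} {i : List L} {a b c d o : List Bool} {v : Reg L}

/-- Put a word on the main stack. -/
def pushWord : List Bool → TreeProg L
  | [] => skip
  | x :: w => .seq (pushWord w) (.push .main fun _ => x)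

theorem exec_pushWord (w : List Bool) :
    Exec (pushWord w) v (stk i a b c d o) (w.length + 1) v (stk i (w ++ a) b c d o) := by
  induction w with
  | nil => exact exec_skip
  | cons x w ih => exact .mono (.seq ih exec_push_main) (by simp)

open Classical in
/-- Put the word `w l` on the main stack, where `l` is the letter of the list `ls` that the
register holds. -/
noncomputable def emit (w : L → List Bool) : List L → TreeProg L
  | [] => skip
  | l :: ls => .ite (fun v => decide (v.2 = some l)) (pushWord (w l)) (emit w ls)

/-- One time bound serves all letters of the list and all stack contents. -/
theorem exec_emit (w : L → List Bool) (ls : List L) : ∃ n : ℕ, ∀ l ∈ ls, ∀ i a b c d o,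
    Exec (emit w ls) (none, some l) (stk i a b c d o) n (none, some l)
      (stk i (w l ++ a) b c d o) := by
  induction ls with
  | nil => exact ⟨0, by simp⟩
  | cons l ls ih =>
    obtain ⟨n, hn⟩ := ih
    refine ⟨n + (w l).length + 2, fun l' hl' i a b c d o => ?_⟩
    by_cases h : l' = l
    · subst h
      exact .mono (.ite_true (by simp) (exec_pushWord (w l'))) (by omega)
    · exact .mono (.ite_false (by simp [h]) (hn l' (List.mem_of_ne_of_mem h hl') i a b c d o))
        (by omega)

/-- Read a letter of the input into the register. -/
def read : TreeProg L := .pop .inp fun _ x => (none, x)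

theorem exec_read :
    Exec read v (stk i a b c d o) 1 (none, i.head?) (stk i.tail a b c d o) :=
  exec_pop (by funext k; cases k <;> rfl)

/-- Translate the input into a list on the main stack, in reverse order. -/
noncomputable def readAll (w : L → List Bool) (ls : List L) : TreeProg L :=
  -- `false` is the code of the empty list; the code of a token with `true` on top prepends that
  -- token.
  .seq (.push .main fun _ => false) (.seq read
    (.loop (fun v => v.2.isSome) (.seq (emit w ls) (.seq (.push .main fun _ => true) read))))

theorem exec_readAll [Finite L] {τ : Type} [TreeEncodable τ] (tok : L → τ) :
    ∃ (p : TreeProg L) (C : ℕ), ∀ i, size (i.map tok).reverse ≤ (C + 3) * i.length + 4 ∧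
      Exec p empty (stk i [] [] [] [] []) ((C + 3) * i.length + 4) empty
      (stk [] ((enc (i.map tok).reverse).code ++ []) [] [] [] []) := by
  have := Fintype.ofFinite L
  obtain ⟨n, hn⟩ := exec_emit (fun l => (enc (tok l)).code) (Finset.univ : Finset L).toList
  set p := emit (fun l => (enc (tok l)).code) (Finset.univ : Finset L).toList
  have hsize : ∃ m, ∀ l, size (tok l) ≤ m :=
    ⟨Finset.univ.sup fun l => size (tok l), fun l =>
      Finset.le_sup (f := fun l => size (tok l)) (Finset.mem_univ l)⟩
  obtain ⟨m, hm⟩ := hsize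
  have hloop : ∀ (i : List L) (y : List τ),
      Exec (.loop (fun v : Reg L => v.2.isSome) (.seq p (.seq (.push .main fun _ => true) read)))
        (none, i.head?) (stk i.tail (enc y).code [] [] [] []) ((n + m + 3) * i.length + 1) empty
        (stk [] (enc ((i.map tok).reverse ++ y)).code [] [] [] []) := by
    intro i
    induction i with
    | nil => exact fun y => .mono (.loop_false rfl) (by omega)
    | cons l i ih =>
      intro y
      have ih := ih (tok l :: y)
      have h := hn l (by simp) i (enc y).code [] [] [] []
      rw [List.map_cons, List.reverse_cons, List.append_assoc]
      refine .mono (.loop_true rfl (.seq h (.seq exec_push_main exec_read)) ih) ?_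
      rw [List.length_cons, Nat.mul_add_one]
      omega
  refine ⟨readAll (fun l => (enc (tok l)).code) (Finset.univ : Finset L).toList, n + m,
    fun i => ⟨?_, ?_⟩⟩
  · rw [size_reverse]
    induction i with
    | nil => simp [size_nil]
    | cons l i ih =>
      have := hm l
      rw [List.map_cons, size_cons, List.length_cons, Nat.mul_add_one]
      omega
  · have h := hloop i []
    rw [List.append_nil] at h ⊢
    exact .mono (.seq exec_push_main (.seq exec_read h)) (by omega)

/-- Move a truth value from the main stack to the output. -/
def answer : TreeProg L :=
  .seq (get .main rfl) (.ite letter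
    -- The other two letters of the code of `true` are removed, as all stacks except the output must
    -- be empty at the end.
    (.seq (get .main rfl) (.seq (get .main rfl) (.seq (.push .out fun _ => true) clear)))
    (.seq (.push .out fun _ => false) clear))

theorem exec_answer (x : Bool) :
    Exec answer v (stk i ((enc x).code ++ []) b c d o) 10 empty (stk i [] b c d (x :: o)) := by
  cases x
  · exact .mono (.seq exec_get_main (.ite_false rfl (.seq exec_push_out exec_clear))) (by omega)
  · exact .mono (.seq exec_get_main (.ite_true rfl (.seq exec_get_main (.seq exec_get_main
      (.seq exec_push_out exec_clear))))) (by omega)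

/-- The Turing machine that runs a program. -/
noncomputable def machine [Finite L] (p : TreeProg L) : FinTM2 :=
  letI := Fintype.ofFinite L
  letI := p.finite_lab
  letI := Fintype.ofFinite p.Lab
  { K := Stk
    k₀ := .inp
    k₁ := .out
    Γ := StkLetter L
    Λ := Option p.Lab
    main := some p.entry
    σ := Reg L
    initialState := empty
    m := fun l => l.elim .halt (p.code some none) }

theorem outputs_machine [Finite L] {p : TreeProg L} {i : List L} {n m : ℕ} {o : List Bool}
    (h : Exec p empty (stk i [] [] [] [] []) n empty (stk [] [] [] [] [] o)) (hm : n + 1 ≤ m) :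
    Nonempty (TM2OutputsInTime (machine p) i (some o) m) := by
  have h1 := h.within (M := (machine p).m) some none fun l => rfl
  have h2 := h1.trans (Within.single (M := (machine p).m) (l := none) (q := .halt) rfl rfl)
  have hi : initList (machine p) i = ⟨some (some p.entry), empty, stk i [] [] [] [] []⟩ := by
    refine congrArg (TM2.Cfg.mk _ _) ?_
    funext k
    cases k <;> rfl
  have ho : haltList (machine p) o = ⟨none, empty, stk [] [] [] [] [] o⟩ := by
    refine congrArg (TM2.Cfg.mk _ _) ?_
    funext k
    cases k <;> rfl
  have key : ∀ c c' : (machine p).Cfg,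
      c = ⟨some (some p.entry), empty, stk i [] [] [] [] []⟩ →
      c' = ⟨none, empty, stk [] [] [] [] [] o⟩ →
      Nonempty (StateTransition.EvalsToInTime (machine p).step c (some c') m) := by
    rintro _ _ rfl rfl
    exact h2.mono hm
  exact key _ _ hi ho

end TreeProg

/-- A problem is in PTIME if it is decided by a polynomial time function on trees, applied to the
reversed list of the translations of the letters of the instance. -/
theorem TreePolyTime.inPTIME {α Γ τ : Type} [Finite Γ] [TreeEncodable τ] {g : List τ → Bool}
    (hg : TreePolyTime g) (encode : α → List Γ) (tok : Γ → τ) {P : α → Prop}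
    (h : ∀ a, g ((encode a).map tok).reverse = true ↔ P a) : InPTIME encode P := by
  obtain ⟨Q, -, hq⟩ := hg
  obtain ⟨q, hq⟩ := hq Γ
  obtain ⟨p, C, hp⟩ := exec_readAll (L := Γ) tok
  refine ⟨fun a => g ((encode a).map tok).reverse, h, ?_⟩
  -- `B` bounds both the time for reading and the size of the list that is read. The 11 below is 10
  -- steps for the answer and one for halting.
  let B : Polynomial ℕ := Polynomial.C (C + 3) * .X + 4
  have hB (n : ℕ) : B.eval n = (C + 3) * n + 4 := by simp [B]
  have key (a : α) : Nonempty (TM2OutputsInTime (machine (L := Γ) (.seq p (.seq q answer)))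
      (encode a) (some [g ((encode a).map tok).reverse])
      ((B + Q.comp B + 11).eval (encode a).length)) := by
    obtain ⟨h1, h2⟩ := hp (encode a)
    refine outputs_machine (L := Γ) (.seq h2 (.seq (hq _ _) (exec_answer _))) ?_
    have := Q.eval_mono_nat h1
    simp only [Polynomial.eval_add, Polynomial.eval_comp, hB, Polynomial.eval_ofNat]
    omega
  exact ⟨{
    tm := machine (L := Γ) (.seq p (.seq q answer))
    inputAlphabet := Equiv.refl Γ
    outputAlphabet := Equiv.refl Bool
    time := B + Q.comp B + 11
    outputsFun := fun a => by
      have e : List.map (Equiv.refl Γ).invFun (encode a) = encode a := List.map_id _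
      exact e.symm ▸ (key a).some }⟩

/-! ### Coding and parsing of databases -/

/-- The representation of facts in computations: the code of the predicate, and the arguments. -/
abbrev FactCode : Type := List Bool × List Const

section Coding

variable {S : Signature} (c : S.Pred → List Bool)

/-- The representation of a fact. -/
def DBFact.toCode (f : DBFact S) : FactCode := (c f.pred, List.ofFn f.args)

theorem DBFact.toCode_injective {c : S.Pred → List Bool} (hc : Injective c) :
    Injective (DBFact.toCode c) := by
  rintro ⟨p, x⟩ ⟨q, y⟩ h
  obtain ⟨h1, h2⟩ := Prod.mk.inj h
  obtain rfl : p = q := hc h1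
  exact congrArg (DBFact.mk p) (List.ofFn_injective h2)

/-- The facts that are represented in a list. -/
def factSet (R : List FactCode) : Set (DBFact S) := {f | f.toCode c ∈ R}

/-- Letters of databases, as they are handed to a computation. -/
def Letter.token : Letter S → Bool × List Bool
  | .pred p => (true, c p)
  | .bit b => (false, [b])
  | .sep => (false, [])

end Coding

/-- One step in parsing a database from right to left: the state consists of the arguments and the
facts that were read. -/
def parseStep (t : Bool × List Bool) (s : List Const × List FactCode) :
    List Const × List FactCode :=
  -- From the right, the end marker of a constant comes before its bits and the predicate after all
  -- its arguments, so the arity need not be consulted.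
  cond t.1 ([], (t.2, s.1) :: s.2) (cond t.2.isEmpty ([] :: s.1, s.2)
    ((t.2.headD false :: s.1.headD []) :: s.1.tail, s.2))

section Parse

variable {S : Signature} (c : S.Pred → List Bool)

theorem foldr_parseStep_const (w : Const) (s : List Const × List FactCode) :
    ((w.map Letter.bit ++ [Letter.sep (S := S)]).map (Letter.token c)).foldr parseStep s
      = (w :: s.1, s.2) := by
  induction w with
  | nil => rfl
  | cons b w ih =>
    rw [List.map_cons, List.cons_append, List.map_cons, List.foldr_cons, ih]
    rfl

theorem foldr_parseStep_args (l : List Const) (s : List Const × List FactCode) :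
    ((l.flatMap fun w => w.map Letter.bit ++ [Letter.sep (S := S)]).map (Letter.token c)).foldr
      parseStep s = (l ++ s.1, s.2) := by
  induction l with
  | nil => rfl
  | cons w l ih =>
    rw [List.flatMap_cons, List.map_append, List.foldr_append, ih, foldr_parseStep_const]
    rfl

theorem foldr_parseStep_encode (D : Database S) :
    (D.encode.map (Letter.token c)).foldr parseStep ([], [])
      = ([], D.list.map (DBFact.toCode c)) := by
  rw [Database.encode]
  induction D.list with
  | nil => rfl
  | cons f l ih =>
    rw [List.flatMap_cons, List.map_append, List.foldr_append, ih, DBFact.encode, List.map_cons,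
      List.foldr_cons, foldr_parseStep_args]
    simp [parseStep, Letter.token, DBFact.toCode]

/-- The facts that are written in a reversed list of tokens. -/
def parse (l : List (Bool × List Bool)) : List FactCode :=
  (l.foldl (fun s t => parseStep t s) ([], [])).2

theorem parse_encode (D : Database S) :
    parse (D.encode.map (Letter.token c)).reverse = D.list.map (DBFact.toCode c) := by
  rw [parse, List.foldl_reverse, foldr_parseStep_encode]

theorem size_parseStep_le (t : Bool × List Bool) (s : List Const × List FactCode) :
    size (parseStep t s) ≤ size s + size t + 8 := by
  obtain ⟨k, w⟩ := t
  obtain ⟨l, F⟩ := s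
  cases k
  · cases w with
    | nil =>
      simp only [parseStep, cond_false, List.isEmpty_nil, cond_true, size_pair, size_cons, size_nil]
      omega
    | cons b w =>
      have := size_bool_le b
      cases l <;>
      simp only [parseStep, cond_false, List.isEmpty_cons, size_pair, size_cons, size_nil,
        List.headD_cons, List.headD_nil, List.tail_cons, List.tail_nil] <;>
      omega
  · simp only [parseStep, cond_true, size_pair, size_cons, size_nil]
    omega

end Parse

namespace TreePolyTime

theorem parse : TreePolyTime parse := by
  have hstep : TreePolyTime fun z : (Bool × List Bool) × List Const × List FactCode =>
      parseStep z.1 z.2 :=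
    fst'.fst.cond ((const []).pair (cons (fst'.snd.pair snd'.fst) snd'.snd))
      (fst'.snd.isEmpty.cond ((cons (const []) snd'.fst).pair snd'.snd)
        ((cons (cons (headD rfl fst'.snd) (headD rfl snd'.fst)) snd'.fst.tail).pair snd'.snd))
  refine (foldl (α := List (Bool × List Bool)) (l := fun l => l) (s := fun _ => ([], []))
    (f := fun z => parseStep z.2.1 z.2.2) .id (const _) (hstep.comp snd') ⟨9 * .X + 3,
      fun l m hm => ?_⟩).snd
  -- A token adds at most its size plus 8, which is at most 9 times what it contributes to the size
  -- of the list.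
  have h (m : List (Bool × List Bool)) (s : List Const × List FactCode) :
      size (m.foldl (fun s t => parseStep t s) s) ≤ size s + 9 * size m := by
    induction m generalizing s with
    | nil => simp
    | cons t m ih =>
      have h1 := ih (parseStep t s)
      have h2 := size_parseStep_le t s
      rw [List.foldl_cons, size_cons]
      omega
  have h1 := h m ([], [])
  have h2 := size_le_of_sublist hm.sublist
  have h3 : size (([], []) : List Const × List FactCode) = 3 := rfl
  simp
  omega

end TreePolyTime

/-! ### Evaluation of queries over the active domain -/

/-- Does some constant of the list `R` of facts, or the empty constant, satisfy `p`? -/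
def existsConst (R : List FactCode) (p : Const → Bool) : Bool :=
  p [] || R.any fun f => f.2.any p

/-- The constants of a list of facts, and the empty constant. -/
def activeDomain (R : List FactCode) : Set Const := {w | w = [] ∨ ∃ f ∈ R, w ∈ f.2}

theorem existsConst_iff {R : List FactCode} {p : Const → Bool} :
    existsConst R p = true ↔ ∃ w ∈ activeDomain R, p w = true := by
  simp only [existsConst, Bool.or_eq_true, List.any_eq_true, activeDomain, Set.mem_ofPred_eq]
  constructor
  · rintro (h | ⟨f, hf, w, hw, h⟩)
    · exact ⟨[], Or.inl rfl, h⟩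
    · exact ⟨w, Or.inr ⟨f, hf, hw⟩, h⟩
  · rintro ⟨w, rfl | ⟨f, hf, hw⟩, h⟩
    · exact Or.inl h
    · exact Or.inr ⟨f, hf, w, hw, h⟩

/-- Is there a list of `n` constants of `R` which, put before `e`, satisfies `p`? -/
def existsTuple (R : List FactCode) (p : List Const → Bool) : ℕ → List Const → Bool
  | 0, e => p e
  | n + 1, e => existsConst R fun w => existsTuple R p n (w :: e)

theorem existsTuple_iff {R : List FactCode} {p : List Const → Bool} {n : ℕ} {e : List Const} :
    existsTuple R p n e = true ↔
      ∃ l : List Const, l.length = n ∧ (∀ w ∈ l, w ∈ activeDomain R) ∧ p (l ++ e) = true := by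
  induction n generalizing e with
  | zero =>
    constructor
    · exact fun h => ⟨[], rfl, by simp, h⟩
    · rintro ⟨l, hl, -, h⟩
      obtain rfl := List.length_eq_zero_iff.1 hl
      exact h
  | succ n ih =>
    simp only [existsTuple, existsConst_iff, ih]
    constructor
    · rintro ⟨w, hw, l, hl, hl', h⟩
      -- `w` is chosen first and the other constants are put before it.
      refine ⟨l ++ [w], by simp [hl], ?_, by simpa using h⟩
      simp only [List.mem_append, List.mem_singleton]
      rintro x (hx | rfl)
      exacts [hl' x hx, hw]
    · rintro ⟨l, hl, hl', h⟩
      rcases List.eq_nil_or_concat l with rfl | ⟨l, w, rfl⟩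
      · simp at hl
      · refine ⟨w, hl' w (by simp), l, by simpa using hl, fun x hx => hl' x (by simp [hx]), ?_⟩
        simpa using h

namespace TreePolyTime

variable {α : Type} [TreeEncodable α]

theorem existsConst {R : α → List FactCode} {p : α × Const → Bool} (hR : TreePolyTime R)
    (hp : TreePolyTime p) : TreePolyTime fun x => existsConst (R x) fun w => p (x, w) :=
  (hp.comp (TreePolyTime.id.pair (const []))).or
    (any hR (p := fun z : α × FactCode => z.2.2.any fun w => p (z.1, w))
      (any snd'.snd (p := fun z : (α × FactCode) × Const => p (z.1.1, z.2))
        (hp.comp (fst'.fst.pair snd'))))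

/-- For fixed `n` these are `n` nested loops over the active domain. The prefix `e` becomes part of
the argument, because it grows in the induction. -/
theorem existsTuple {R : α → List FactCode} {p : α × List Const → Bool} (hR : TreePolyTime R)
    (hp : TreePolyTime p) (n : ℕ) {e : α → List Const} (he : TreePolyTime e) :
    TreePolyTime fun x => existsTuple (R x) (fun l => p (x, l)) n (e x) := by
  suffices h : TreePolyTime fun z : α × List Const =>
      _root_.existsTuple (R z.1) (fun l => p (z.1, l)) n z.2 from
    h.comp (TreePolyTime.id.pair he)
  induction n with
  | zero => exact hp
  | succ n ih =>
    exact existsConst (hR.comp fst') (p := fun z : (α × List Const) × Const =>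
      _root_.existsTuple (R z.1.1) (fun l => p (z.1.1, l)) n (z.2 :: z.1.2))
      (ih.comp (fst'.fst.pair (cons snd' fst'.snd)))

end TreePolyTime

/-- The assignment that is given by a list of constants. -/
def assign (e : List Const) : Var → Const := fun x => e.getD x []

/-- The empty constant is in `activeDomain` because it is the default value of `assign`; it also
provides a value for variables that do not matter. -/
theorem assign_mem {e : List Const} {R : List FactCode} (h : ∀ w ∈ e, w ∈ activeDomain R)
    (x : Var) : assign e x ∈ activeDomain R := by
  rw [assign, List.getD_eq_getElem?_getD]
  cases hx : e[x]? with
  | none => exact Or.inl rfl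
  | some w => exact h w (List.mem_of_getElem? hx)

theorem exists_assign {R : List FactCode} {ν : Var → Const} {n : ℕ}
    (h : ∀ x < n, ν x ∈ activeDomain R) :
    ∃ l : List Const, l.length = n ∧ (∀ w ∈ l, w ∈ activeDomain R) ∧ ∀ x < n, assign l x = ν x := by
  refine ⟨(List.range n).map ν, by simp, ?_, fun x hx => ?_⟩
  · simp only [List.mem_map, List.mem_range]
    rintro w ⟨x, hx, rfl⟩
    exact h x hx
  · simp [assign, hx]

section Evaluation

variable {S : Signature} (c : S.Pred → List Bool)

/-- Evaluation of the inequalities of a conjunction. -/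
def Conjunction.evalIneqs (γ : Conjunction S) (e : List Const) : Bool :=
  γ.ineqs.all fun i => !(i.1.val (assign e) == i.2.val (assign e))

/-- Evaluation of a conjunction. -/
def Conjunction.eval (γ : Conjunction S) (R : List FactCode) (e : List Const) : Bool :=
  (γ.atoms.all fun α => R.any fun f => f == (α.ground (assign e)).toCode c) && γ.evalIneqs e

/-- Evaluation of a conjunctive query all whose variables are less than `n`. -/
def CQ.eval (q : CQ S) (n : ℕ) (R : List FactCode) (e : List Const) : Bool :=
  -- All `n` variables are chosen anew, and those that are not quantified are compared with `e`.
  existsTuple R (fun l => ((List.range n).filter (· ∉ q.exVars)).all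
    (fun x => assign l x == assign e x) && q.conj.eval c R l) n []

/-- Evaluation of a union of conjunctive queries all whose variables are less than `n`. -/
def UCQ.eval (Q : UCQ S) (n : ℕ) (R : List FactCode) (e : List Const) : Bool :=
  Q.cqs.any fun q => q.eval c n R e

/-- Does a fact violate a dependency all whose variables are less than `n`? -/
def Dependency.violatedBy (τ : Dependency S) (n : ℕ) (R : List FactCode) (f : FactCode) : Bool :=
  existsTuple R (fun l => (τ.body.atoms.all fun α => f == (α.ground (assign l)).toCode c) &&
    τ.body.evalIneqs l && !τ.head.eval c n R l) n []

/-- Removal of all facts that violate some dependency. -/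
def removeViolating (T : List (Dependency S)) (n : ℕ) (R : List FactCode) : List FactCode :=
  R.filter fun f => T.all fun τ => !τ.violatedBy c n R f

end Evaluation

namespace TreePolyTime

variable {α : Type} [TreeEncodable α] {S : Signature} (c : S.Pred → List Bool)
  {R : α → List FactCode} {e : α → List Const}

theorem val (t : Term) (he : TreePolyTime e) : TreePolyTime fun x => t.val (assign (e x)) := by
  cases t with
  | var x => exact getD rfl he x
  | const w => exact const w

theorem toCode_ground (a : Atom S) (he : TreePolyTime e) :
    TreePolyTime fun x => (a.ground (assign (e x))).toCode c := by
  refine (const (c a.pred)).pair ?_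
  simp only [Atom.ground, List.ofFn_eq_map]
  exact listMap _ fun i _ => val (a.args i) he

theorem evalIneqs (γ : Conjunction S) (he : TreePolyTime e) :
    TreePolyTime fun x => γ.evalIneqs (e x) :=
  listAll _ fun i _ => (beq (val i.1 he) (val i.2 he)).not

theorem evalConjunction (γ : Conjunction S) (hR : TreePolyTime R) (he : TreePolyTime e) :
    TreePolyTime fun x => γ.eval c (R x) (e x) :=
  (listAll _ fun a _ => any hR (p := fun z => z.2 == (a.ground (assign (e z.1))).toCode c)
    (beq (g := fun z : α × FactCode => (a.ground (assign (e z.1))).toCode c) snd'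
      (toCode_ground c a (e := fun z : α × FactCode => e z.1) (he.comp fst')))).and (evalIneqs γ he)

theorem evalCQ (q : CQ S) (n : ℕ) (hR : TreePolyTime R) (he : TreePolyTime e) :
    TreePolyTime fun x => q.eval c n (R x) (e x) :=
  existsTuple hR (p := fun z => ((List.range n).filter (· ∉ q.exVars)).all
    (fun x => assign z.2 x == assign (e z.1) x) && q.conj.eval c (R z.1) z.2)
    ((listAll _ fun x _ => beq (getD rfl snd' x) (getD rfl (he.comp fst') x)).and
      (evalConjunction c q.conj (hR.comp fst') snd')) n (const [])

theorem evalUCQ (Q : UCQ S) (n : ℕ) (hR : TreePolyTime R) (he : TreePolyTime e) :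
    TreePolyTime fun x => Q.eval c n (R x) (e x) :=
  listAny _ fun q _ => evalCQ c q n hR he

theorem violatedBy (τ : Dependency S) (n : ℕ) {f : α → FactCode} (hR : TreePolyTime R)
    (hf : TreePolyTime f) : TreePolyTime fun x => τ.violatedBy c n (R x) (f x) :=
  existsTuple hR (p := fun z =>
    (τ.body.atoms.all fun a => f z.1 == (a.ground (assign z.2)).toCode c) &&
      τ.body.evalIneqs z.2 && !τ.head.eval c n (R z.1) z.2)
    (((listAll _ fun a _ => beq (hf.comp fst') (toCode_ground c a snd')).and
      (evalIneqs τ.body snd')).and (evalUCQ c τ.head n (hR.comp fst') snd').not) n (const [])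

theorem removeViolating (T : List (Dependency S)) (n : ℕ) :
    TreePolyTime (removeViolating c T n) :=
  filter .id (p := fun z => T.all fun τ => !τ.violatedBy c n z.1 z.2)
    (listAll _ fun τ _ => (violatedBy c τ n fst' snd').not)

/-- The parsed list is both the start of the iteration and its clock; filtering never increases
sizes. -/
theorem evalRepair (T : List (Dependency S)) (Q : UCQ S) (n : ℕ) :
    TreePolyTime fun l : List (Bool × List Bool) =>
      Q.eval c n ((_root_.removeViolating c T n)^[(_root_.parse l).length] (_root_.parse l)) [] :=
  evalUCQ c Q n (iterate parse parse (removeViolating c T n) fun _ =>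
    size_le_of_sublist List.filter_sublist) (const [])

end TreePolyTime

/-! ### Dependence of truth on assignments and on the set of facts -/

section Congruence

variable {S : Signature}

theorem Term.val_congr {ν ν' : Var → Const} {t : Term} (h : ∀ x, t = .var x → ν x = ν' x) :
    t.val ν = t.val ν' := by
  cases t with
  | var x => exact h x rfl
  | const w => rfl

theorem Atom.ground_congr {ν ν' : Var → Const} {α : Atom S} (h : ∀ x ∈ α.vars, ν x = ν' x) :
    α.ground ν = α.ground ν' :=
  congrArg (DBFact.mk α.pred) (funext fun i => Term.val_congr fun x hx => h x ⟨i, hx⟩)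

theorem Conjunction.ground_congr {γ : Conjunction S} {ν ν' : Var → Const}
    (h : ∀ x ∈ γ.vars, ν x = ν' x) {α : Atom S} (hα : α ∈ γ.atoms) : α.ground ν = α.ground ν' :=
  Atom.ground_congr fun x hx => h x (Or.inl ⟨α, hα, hx⟩)

theorem Conjunction.ineqs_congr {γ : Conjunction S} {ν ν' : Var → Const}
    (h : ∀ x ∈ γ.vars, ν x = ν' x) (H : ∀ e ∈ γ.ineqs, e.1.val ν ≠ e.2.val ν) :
    ∀ e ∈ γ.ineqs, e.1.val ν' ≠ e.2.val ν' := fun e he => by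
  rw [← Term.val_congr fun x hx => h x (Or.inr ⟨e, he, Or.inl hx⟩),
    ← Term.val_congr fun x hx => h x (Or.inr ⟨e, he, Or.inr hx⟩)]
  exact H e he

theorem Conjunction.Holds.congr {D : Set (DBFact S)} {γ : Conjunction S} {ν ν' : Var → Const}
    (h : ∀ x ∈ γ.vars, ν x = ν' x) (H : γ.Holds D ν) : γ.Holds D ν' :=
  ⟨fun α hα => γ.ground_congr h hα ▸ H.1 α hα, γ.ineqs_congr h H.2⟩

theorem CQ.Holds.congr {D : Set (DBFact S)} {q : CQ S} {ν ν' : Var → Const}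
    (h : ∀ x ∈ q.freeVars, ν x = ν' x) (H : q.Holds D ν) : q.Holds D ν' := by
  classical
  obtain ⟨μ, hμ, H⟩ := H
  refine ⟨fun x => if x ∈ q.exVars then μ x else ν' x, fun x hx => if_neg hx,
    H.congr fun x hx => ?_⟩
  by_cases hx' : x ∈ q.exVars
  · rw [if_pos hx']
  · rw [if_neg hx', hμ x hx', h x ⟨hx, hx'⟩]

theorem UCQ.Holds.congr {D : Set (DBFact S)} {Q : UCQ S} {ν ν' : Var → Const}
    (h : ∀ q ∈ Q.cqs, ∀ x ∈ q.freeVars, ν x = ν' x) (H : Q.Holds D ν) : Q.Holds D ν' := by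
  obtain ⟨q, hq, H⟩ := H
  exact ⟨q, hq, H.congr (h q hq)⟩

theorem UCQ.models_iff {D : Set (DBFact S)} {Q : UCQ S} (hQ : Q.IsBoolean) (ν : Var → Const) :
    Q.Models D ↔ Q.Holds D ν :=
  ⟨fun h => h ν, fun h _ => h.congr fun q hq x hx => by rw [hQ q hq] at hx; exact hx.elim⟩

/-- The set of facts enters through positive atoms only; inequalities do not depend on it. -/
theorem CQ.Holds.mono {D D' : Set (DBFact S)} (hD : D ⊆ D') {q : CQ S} {ν : Var → Const}
    (H : q.Holds D ν) : q.Holds D' ν := by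
  obtain ⟨μ, hμ, H⟩ := H
  exact ⟨μ, hμ, fun α hα => hD (H.1 α hα), H.2⟩

theorem Conjunction.finite_vars (γ : Conjunction S) : γ.vars.Finite := by
  have ht (t : Term) : {x | t = Term.var x}.Finite := by
    cases t with
    | var y => exact (Set.finite_singleton y).subset fun x hx => (Term.var.inj hx).symm
    | const w => exact Set.finite_empty.subset fun x hx => Term.noConfusion hx
  refine Set.Finite.union ?_ ?_
  · have : γ.atomVars = ⋃ α ∈ {α | α ∈ γ.atoms}, ⋃ i, {x | α.args i = Term.var x} := by
      ext x
      simp [Conjunction.atomVars, Conjunction.PA, Atom.vars]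
    rw [this]
    exact γ.atoms.finite_toSet.biUnion fun α _ => Set.finite_iUnion fun i => ht _
  · refine (γ.ineqs.finite_toSet.biUnion fun e _ => (ht e.1).union (ht e.2)).subset ?_
    rintro x ⟨e, he, h⟩
    exact Set.mem_biUnion he h

/-- There is a bound on the variables in finitely many finite sets. -/
theorem exists_var_bound {ι : Type} {s : Set ι} (hs : s.Finite) {V : ι → Set Var}
    (hV : ∀ i ∈ s, (V i).Finite) : ∃ n : ℕ, ∀ i ∈ s, ∀ x ∈ V i, x < n := by
  obtain ⟨n, hn⟩ := (hs.biUnion hV).bddAbove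
  exact ⟨n + 1, fun i hi x hx => Nat.lt_succ_of_le (hn (Set.mem_biUnion hi hx))⟩

end Congruence

/-! ### Correctness of the evaluation -/

section Evaluation

variable {S : Signature} {c : S.Pred → List Bool} {R : List FactCode}

/-- This is where safety is exploited: a variable in a true atom takes its value in the active
domain, so the finite search misses nothing. -/
theorem mem_activeDomain_of_ground {α : Atom S} {ν : Var → Const}
    (h : α.ground ν ∈ factSet c R) {x : Var} (hx : x ∈ α.vars) : ν x ∈ activeDomain R := by
  obtain ⟨i, hi⟩ := hx
  refine Or.inr ⟨_, h, ?_⟩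
  simp only [DBFact.toCode, Atom.ground, List.mem_ofFn]
  exact ⟨i, by rw [hi]; rfl⟩

theorem Conjunction.evalIneqs_iff {γ : Conjunction S} {e : List Const} :
    γ.evalIneqs e = true ↔ ∀ i ∈ γ.ineqs, i.1.val (assign e) ≠ i.2.val (assign e) := by
  simp [Conjunction.evalIneqs]

theorem Conjunction.eval_iff {γ : Conjunction S} {e : List Const} :
    γ.eval c R e = true ↔ γ.Holds (factSet c R) (assign e) := by
  simp [Conjunction.eval, Conjunction.evalIneqs_iff, Conjunction.Holds, factSet]

theorem CQ.eval_iff {q : CQ S} {n : ℕ} {e : List Const} (hn : ∀ x ∈ q.conj.vars, x < n)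
    (hq : ∀ y ∈ q.exVars, y ∈ q.conj.atomVars) (he : ∀ w ∈ e, w ∈ activeDomain R) :
    q.eval c n R e = true ↔ q.Holds (factSet c R) (assign e) := by
  classical
  simp only [CQ.eval, existsTuple_iff, List.append_nil, Bool.and_eq_true, List.all_eq_true,
    Conjunction.eval_iff, List.mem_filter, List.mem_range, decide_eq_true_eq, beq_iff_eq]
  constructor
  · rintro ⟨l, -, -, hle, h⟩
    -- The comparison with `e` covers only variables below `n`, so the others are taken from `e`
    -- directly.
    refine ⟨fun x => if x < n then assign l x else assign e x, fun x hx => ?_,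
      h.congr fun x hx => (if_pos (hn x hx)).symm⟩
    by_cases hxn : x < n
    · exact (if_pos hxn).trans (hle x ⟨hxn, hx⟩)
    · exact if_neg hxn
  · rintro ⟨μ, hμ, h⟩
    obtain ⟨l, hl, hl', hlμ⟩ := exists_assign (R := R) (ν := μ) (n := n) fun x _ => by
      by_cases hx : x ∈ q.exVars
      · obtain ⟨α, hα, hxα⟩ := hq x hx
        exact mem_activeDomain_of_ground (h.1 α hα) hxα
      · rw [hμ x hx]
        exact assign_mem he x
    exact ⟨l, hl, hl', fun x hx => (hlμ x hx.1).trans (hμ x hx.2),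
      h.congr fun x hx => (hlμ x (hn x hx)).symm⟩

theorem UCQ.eval_iff {Q : UCQ S} {n : ℕ} {e : List Const}
    (hn : ∀ q ∈ Q.cqs, ∀ x ∈ q.conj.vars, x < n)
    (hQ : ∀ q ∈ Q.cqs, ∀ y ∈ q.exVars, y ∈ q.conj.atomVars)
    (he : ∀ w ∈ e, w ∈ activeDomain R) :
    Q.eval c n R e = true ↔ Q.Holds (factSet c R) (assign e) := by
  simp only [UCQ.eval, List.any_eq_true, UCQ.Holds]
  exact exists_congr fun q => and_congr_right fun hq => CQ.eval_iff (hn q hq) (hQ q hq) he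

end Evaluation

/-! ### Linear dependencies are tested fact by fact -/

section LinearDependencies

variable {S : Signature}

/-- In `D`, the dependency `τ` is satisfied wherever all its body atoms become the fact `f`. -/
def Dependency.SatisfiedAt (τ : Dependency S) (D : Set (DBFact S)) (f : DBFact S) : Prop :=
  ∀ ν : Var → Const, (∀ α ∈ τ.body.atoms, α.ground ν = f) →
    (∀ e ∈ τ.body.ineqs, e.1.val ν ≠ e.2.val ν) → τ.head.Holds D ν

/-- The body is matched against `f` alone, so `D` matters only for the head, which is monotone. -/
theorem Dependency.SatisfiedAt.mono {τ : Dependency S} {D D' : Set (DBFact S)} {f : DBFact S}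
    (h : τ.SatisfiedAt D f) (hD : D ⊆ D') : τ.SatisfiedAt D' f := fun ν h1 h2 => by
  obtain ⟨q, hq, H⟩ := h ν h1 h2
  exact ⟨q, hq, H.mono hD⟩

theorem Dependency.IsLinear.satisfied_iff {τ : Dependency S} (hτ : τ.IsLinear)
    {D : Set (DBFact S)} : τ.Satisfied D ↔ ∀ f ∈ D, τ.SatisfiedAt D f := by
  obtain ⟨α, hα⟩ := Set.ncard_eq_one.1 hτ
  -- Linearity counts the set of atoms, so the list may repeat `α`.
  have hmem (β : Atom S) : β ∈ τ.body.atoms ↔ β = α :=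
    (show β ∈ τ.body.atoms ↔ β ∈ τ.body.PA from Iff.rfl).trans (by rw [hα]; rfl)
  constructor
  · exact fun h f hf ν h1 h2 => h ν ⟨fun β hβ => (h1 β hβ).symm ▸ hf, h2⟩
  · intro h ν H
    refine h (α.ground ν) (H.1 α ((hmem α).2 rfl)) ν (fun β hβ => ?_) H.2
    rw [(hmem β).1 hβ]

theorem Dependency.violatedBy_iff {c : S.Pred → List Bool} (hc : Injective c) {τ : Dependency S}
    {n : ℕ} (hn : ∀ x ∈ τ.body.vars, x < n)
    (hn' : ∀ q ∈ τ.head.cqs, ∀ x ∈ q.conj.vars, x < n) {R : List FactCode} {f : DBFact S}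
    (hf : f ∈ factSet c R) :
    τ.violatedBy c n R (f.toCode c) = true ↔ ¬ τ.SatisfiedAt (factSet c R) f := by
  classical
  simp only [Dependency.violatedBy, existsTuple_iff, List.append_nil, Bool.and_eq_true,
    List.all_eq_true, Conjunction.evalIneqs_iff, beq_iff_eq, (DBFact.toCode_injective hc).eq_iff,
    Bool.not_eq_true']
  constructor
  · rintro ⟨l, -, hl, ⟨h1, h2⟩, h3⟩ H
    have := H (assign l) (fun α hα => (h1 α hα).symm) h2
    rw [← UCQ.eval_iff hn' τ.head_safe hl, h3] at this
    exact Bool.false_ne_true this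
  · intro H
    simp only [Dependency.SatisfiedAt, not_forall] at H
    obtain ⟨ν, h1, h2, h3⟩ := H
    -- Variables of the body take values in `f`, by safety. All others are reset to the empty
    -- constant, which is harmless since the free variables of the head occur in the body.
    obtain ⟨l, hl, hl', hlν⟩ := exists_assign (R := R) (n := n)
      (ν := fun x => if x ∈ τ.body.vars then ν x else []) fun x _ => by
        by_cases hx : x ∈ τ.body.vars
        · obtain ⟨α, hα, hxα⟩ := τ.body_safe x hx
          rw [if_pos hx]
          exact mem_activeDomain_of_ground (h1 α hα ▸ hf) hxα
        · rw [if_neg hx]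
          exact Or.inl rfl
    have hag : ∀ x ∈ τ.body.vars, ν x = assign l x := fun x hx => by
      rw [hlν x (hn x hx), if_pos hx]
    refine ⟨l, hl, hl', ⟨fun α hα => ?_, τ.body.ineqs_congr hag h2⟩, ?_⟩
    · rw [← τ.body.ground_congr hag hα, h1 α hα]
    · rw [Bool.eq_false_iff, Ne, UCQ.eval_iff hn' τ.head_safe hl']
      exact fun H => h3 (H.congr fun q hq x hx => (hag x (τ.head_free q hq x hx)).symm)

end LinearDependencies

/-- Iterated filtering of a list becomes stationary after as many steps as the list is long. -/
theorem iterate_length_fixed {α : Type} {F : List α → List α} (hF : ∀ l, (F l).Sublist l)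
    (l : List α) : F (F^[l.length] l) = F^[l.length] l := by
  suffices h : ∀ n (l : List α), l.length ≤ n → F (F^[n] l) = F^[n] l from h _ l le_rfl
  intro n
  induction n with
  | zero =>
    intro l hl
    obtain rfl := List.length_eq_zero_iff.1 (Nat.le_zero.1 hl)
    exact List.sublist_nil.1 (hF [])
  | succ n ih =>
    intro l hl
    by_cases h : F l = l
    · rw [Function.iterate_fixed h, h]
    · refine ih (F l) ?_
      have := (hF l).length_le
      have : (F l).length ≠ l.length := fun he => h ((hF l).eq_of_length he)
      omega

/-! ### The unique repair -/

section UniqueRepair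

variable {S : Signature} {T : Set (Dependency S)} {L : List (Dependency S)}
  {c : S.Pred → List Bool} {n : ℕ}

theorem mem_factSet_removeViolating (hT : ∀ τ, τ ∈ L ↔ τ ∈ T) (hc : Injective c)
    (hn : ∀ τ ∈ T, ∀ x ∈ τ.body.vars, x < n)
    (hn' : ∀ τ ∈ T, ∀ q ∈ τ.head.cqs, ∀ x ∈ q.conj.vars, x < n) {R : List FactCode} {f : DBFact S} :
    f ∈ factSet c (removeViolating c L n R) ↔
      f ∈ factSet c R ∧ ∀ τ ∈ T, τ.SatisfiedAt (factSet c R) f := by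
  simp only [factSet, removeViolating, Set.mem_ofPred_eq, List.mem_filter, List.all_eq_true,
    Bool.not_eq_true']
  refine and_congr_right fun hf => ?_
  simp only [hT]
  refine forall₂_congr fun τ hτ => ?_
  rw [Bool.eq_false_iff, Ne, Dependency.violatedBy_iff hc (hn τ hτ) (hn' τ hτ) hf,
    not_not]
  rfl

/-- The removal of violating facts, iterated, leads to the only repair. -/
theorem isRepair_iff (hT : ∀ τ, τ ∈ L ↔ τ ∈ T) (hlin : ∀ τ ∈ T, τ.IsLinear)
    (hc : Injective c) (hn : ∀ τ ∈ T, ∀ x ∈ τ.body.vars, x < n)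
    (hn' : ∀ τ ∈ T, ∀ q ∈ τ.head.cqs, ∀ x ∈ q.conj.vars, x < n) (R : List FactCode)
    {X : Set (DBFact S)} :
    IsRepair T (factSet c R) X ↔ X = factSet c ((removeViolating c L n)^[R.length] R) := by
  have hmem {R : List FactCode} {f : DBFact S} :=
    mem_factSet_removeViolating (R := R) (f := f) hT hc hn hn'
  have hcons : Consistent T (factSet c ((removeViolating c L n)^[R.length] R)) := fun τ hτ => by
    rw [(hlin τ hτ).satisfied_iff]
    intro f hf
    -- At the fixed point, the remaining facts have passed the test against the very set that
    -- remains.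
    have hfix := iterate_length_fixed (F := removeViolating c L n)
      (fun l => List.filter_sublist) R
    rw [← hfix] at hf
    exact (hmem.1 hf).2 τ hτ
  have hsub (m : ℕ) (R : List FactCode) :
      factSet c ((removeViolating c L n)^[m] R) ⊆ factSet c R := by
    induction m generalizing R with
    | zero => exact subset_rfl
    | succ m ih => exact (ih _).trans fun f hf => (hmem.1 hf).1
  -- A consistent subset survives every round: its facts satisfy the dependencies within `Y`, hence
  -- also within the larger current set. The result is thus the greatest consistent subset, not
  -- merely a maximal one.
  have hmax (Y : Set (DBFact S)) (hY : Consistent T Y) (m : ℕ) (R : List FactCode)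
      (hYR : Y ⊆ factSet c R) : Y ⊆ factSet c ((removeViolating c L n)^[m] R) := by
    induction m generalizing R with
    | zero => exact hYR
    | succ m ih =>
      exact ih _ fun f hf => hmem.2 ⟨hYR hf, fun τ hτ =>
        ((hlin τ hτ).satisfied_iff.1 (hY τ hτ) f hf).mono hYR⟩
  constructor
  · exact fun h => (hmax X h.prop.2 _ R h.prop.1).antisymm
      (h.le_of_ge ⟨hsub _ R, hcons⟩ (hmax X h.prop.2 _ R h.prop.1))
  · rintro rfl
    exact ⟨⟨hsub _ R, hcons⟩, fun Y hY _ => hmax Y hY.2 _ R hY.1⟩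

end UniqueRepair

/-! ### The theorem -/

theorem finite_letter (S : Signature) [Finite S.Pred] : Finite (Letter S) := by
  refine Finite.of_injective (β := S.Pred ⊕ Bool ⊕ Unit) (fun
    | .pred p => .inl p
    | .bit b => .inr (.inl b)
    | .sep => .inr (.inr ())) ?_
  rintro (p | b | _) (p' | b' | _) h <;> simp_all

theorem exists_predCode (S : Signature) [Finite S.Pred] :
    ∃ c : S.Pred → List Bool, Injective c := by
  obtain ⟨m, ⟨e⟩⟩ := Finite.exists_equiv_fin S.Pred
  refine ⟨fun p => List.replicate (e p) true, fun p q h => e.injective (Fin.ext ?_)⟩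
  simpa using congrArg List.length h

theorem mainTheorem7 (S : Signature) [Finite S.Pred]
    (T : Set (Dependency S)) (hT : T.Finite) (hlin : ∀ τ ∈ T, τ.IsLinear)
    (Q : UCQ S) (hQsafe : Q.IsSafe) (hQbool : Q.IsBoolean) :
    InPTIME (Database.encode (S := S)) (fun D => IAREntails T D.facts Q) ∧
    InPTIME (Database.encode (S := S)) (fun D => AREntails T D.facts Q) ∧
    ∀ D : Database S, AREntails T D.facts Q ↔ IAREntails T D.facts Q := by
  have := finite_letter S
  obtain ⟨c, hc⟩ := exists_predCode S
  obtain ⟨n₁, hn₁⟩ := exists_var_bound hT (V := fun τ => τ.body.vars) fun τ _ =>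
    τ.body.finite_vars
  obtain ⟨n₂, hn₂⟩ := exists_var_bound hT
    (V := fun τ => ⋃ q ∈ {q | q ∈ τ.head.cqs}, q.conj.vars) fun τ _ =>
      τ.head.cqs.finite_toSet.biUnion fun q _ => q.conj.finite_vars
  obtain ⟨n₃, hn₃⟩ := exists_var_bound Q.cqs.finite_toSet (V := fun q => q.conj.vars) fun q _ =>
    q.conj.finite_vars
  obtain ⟨n, hsum⟩ : ∃ n : ℕ, n = n₁ + n₂ + n₃ := ⟨_, rfl⟩
  have hn : ∀ τ ∈ T, ∀ x ∈ τ.body.vars, x < n := fun τ hτ x hx =>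
    Nat.lt_of_lt_of_le (hn₁ τ hτ x hx) (by omega)
  have hn' : ∀ τ ∈ T, ∀ q ∈ τ.head.cqs, ∀ x ∈ q.conj.vars, x < n := fun τ hτ q hq x hx =>
    Nat.lt_of_lt_of_le (hn₂ τ hτ x (Set.mem_biUnion hq hx)) (by omega)
  have hnQ : ∀ q ∈ Q.cqs, ∀ x ∈ q.conj.vars, x < n := fun q hq x hx =>
    Nat.lt_of_lt_of_le (hn₃ q hq x hx) (by omega)
  let L := hT.toFinset.toList
  have hL : ∀ τ, τ ∈ L ↔ τ ∈ T := fun τ => by simp [L]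
  let rep (D : Database S) : List FactCode :=
    (removeViolating c L n)^[(D.list.map (DBFact.toCode c)).length] (D.list.map (DBFact.toCode c))
  have hrep (D : Database S) (X : Set (DBFact S)) :
      IsRepair T D.facts X ↔ X = factSet c (rep D) := by
    have hD : D.facts = factSet c (D.list.map (DBFact.toCode c)) := by
      ext f
      exact ((List.mem_map_of_injective (DBFact.toCode_injective hc)).symm : f ∈ D.list ↔ _)
    rw [hD]
    exact isRepair_iff hL hlin hc hn hn' _
  have hAR (D : Database S) : AREntails T D.facts Q ↔ Q.Models (factSet c (rep D)) := by
    simp only [AREntails, hrep, forall_eq]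
  have hIAR (D : Database S) : IAREntails T D.facts Q ↔ Q.Models (factSet c (rep D)) := by
    have : intRep T D.facts = factSet c (rep D) := by
      ext f
      simp only [intRep, hrep, forall_eq, Set.mem_ofPred_eq]
    rw [IAREntails, this]
  have hmodels (D : Database S) : Q.Models (factSet c (rep D)) ↔ Q.eval c n (rep D) [] = true := by
    -- For a Boolean query any assignment will do; the one given by the empty list meets the
    -- condition on the active domain trivially.
    rw [UCQ.models_iff hQbool (assign []), UCQ.eval_iff hnQ (fun q hq y hy =>
      hQsafe q hq y (q.exVars_occur y hy)) (by simp)]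
  have hdec {P : Database S → Prop} (hP : ∀ D, P D ↔ Q.Models (factSet c (rep D))) :
      InPTIME (Database.encode (S := S)) P :=
    (TreePolyTime.evalRepair c L Q n).inPTIME _ (Letter.token c) fun D => by
      rw [hP, hmodels, parse_encode]
  exact ⟨hdec hIAR, hdec hAR, fun D => (hAR D).trans (hIAR D).symm⟩
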